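/- Let $n\ge 0$. Let $S_m$ be the symmetric group on $[m]=\{1,\dots,m\}$, with $w\in S_m$ written $w_1\cdots w_m$, $w_i=w(i)$, and let $B_n$ be the group of signed permutations, i.e. bijections $w$ of $\{\pm1,\dots,\pm n\}$ with $w(-i)=-w(i)$, written $w_1\cdots w_n$, $w_i=w(i)$. A word $w_1\cdots w_n$ of integers contains a signed pattern $u=u_1\cdots u_m$ if there are $i_1<\dots<i_m$ such that, for all $a,b$, $w_{i_a}<0$ if and only if $u_a<0$, and $|w_{i_a}|<|w_{i_b}|$ if and only if $|u_a|<|u_b|$; otherwise it avoids $u$. Write $\bar k=-k$. Let $K(S_m)$ be the set of separable permutations in $S_m$, i.e. those avoiding $3142$ and $2413$, and let $K(B_n)$ be the set of separable signed permutations in $B_n$, i.e. those avoiding $\bar21$, $2\bar1$, $3142$, $2413$, $\bar3\bar1\bar4\bar2$ and $\bar2\bar4\bar1\bar3$. For $w\in S_m$ put $w_0=w_{m+1}=+\infty$. An index $i\in[m]$ is an A-descent if $w_i>w_{i+1}$, and a double A-descent if $w_{i-1}>w_i>w_{i+1}$. For $w\in B_n$ put $w_0=0$ and $w_{-1}=w_{n+1}=+\infty$.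 An index $i\in\{0,1,\dots,n\}$ is a B-descent if $w_i>w_{i+1}$, and a double B-descent if $w_{i-1}>w_i>w_{i+1}$. Let $\mathrm{des}_A,\mathrm{dd}_A,\mathrm{des}_B,\mathrm{dd}_B$ be the numbers of A-descents, double A-descents, B-descents and double B-descents, and define $$S_m(t)=\sum_{w\in K(S_m)}t^{\mathrm{des}_A(w)},\qquad B_n(t)=\sum_{w\in K(B_n)}t^{\mathrm{des}_B(w)},$$ $$\gamma^S_{m,k}=\#\{w\in K(S_m):\mathrm{dd}_A(w)=0,\ \mathrm{des}_A(w)=k\},\qquad \gamma^B_{n,k}=\#\{w\in K(B_n):\mathrm{dd}_B(w)=0,\ \mathrm{des}_B(w)=k\}.$$ **Theorem.** For every $n\ge0$, $B_n(t)=S_{n+1}(t)$, and $$B_n(t)=\sum_{k=0}^{\lfloor n/2\rfloor}\gamma^B_{n,k}\,t^k(1+t)^{n-2k},\qquad \gamma^B_{n,k}=\gamma^S_{n+1,k}\ \text{ for all }k\ge0.$$ Therefore $B_n(t)$ is $\gamma$-positive (a combination of the polynomials $t^k(1+t)^{n-2k}$, $0\le k\le\lfloor n/2\rfloor$, with non-negative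 coefficients), and hence it is palindromic (it has degree $n$, and for $0\le i\le n$ the coefficients of $t^i$ and $t^{n-i}$ are equal) and unimodal (its coefficients weakly increase up to some index and weakly decrease after it). -/

import Mathlib

open Polynomial

/-- The set `[±n] = {-n, …, -1, 1, …, n}`. -/
abbrev SignedSet (n : ℕ) : Type := {i : ℤ // i ∈ (Finset.Icc (-(n : ℤ)) (n : ℤ)).erase 0}

instance SignedSet.instNeg (n : ℕ) : Neg (SignedSet n) where
  neg i := ⟨-i.1, by
    have h := i.2
    simp only [Finset.mem_erase, Finset.mem_Icc] at h ⊢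
    omega⟩

/-- The hyperoctahedral group `B_n`: bijections `w` of `[±n]` with `w(-i) = -w(i)`. -/
abbrev SignedPerm (n : ℕ) : Type :=
  {w : Equiv.Perm (SignedSet n) // ∀ i : SignedSet n, w (-i) = -(w i)}

/-- One-line notation `w₁ w₂ ⋯ w_n` of a signed permutation, as a word indexed from `0`:
the letter at position `i` is `w(i + 1)`. -/
def SignedPerm.word {n : ℕ} (w : SignedPerm n) (i : Fin n) : ℤ :=
  (w.1 ⟨(i : ℤ) + 1, by
    have h := i.2
    simp only [Finset.mem_erase, Finset.mem_Icc]
    omega⟩).1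

/-- One-line notation `w₁ w₂ ⋯ w_n` of a permutation, with letters in `{1, …, n}`. -/
def permWord {n : ℕ} (w : Equiv.Perm (Fin n)) (i : Fin n) : ℤ := ((w i : ℕ) : ℤ) + 1

/-- The word `a` contains the signed pattern `u`: some subsequence of `a` of the length of `u`
has the same signs as `u`, and its absolute values are in the same relative order as those of `u`,
that is, the signed standardization of the subsequence is `u`. -/
def ContainsPattern {n m : ℕ} (a : Fin n → ℤ) (u : Fin m → ℤ) : Prop :=
  ∃ f : Fin m → Fin n, (∀ i j, i < j → f i < f j) ∧
    (∀ i, a (f i) < 0 ↔ u i < 0) ∧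
    (∀ i j, |a (f i)| < |a (f j)| ↔ |u i| < |u j|)

instance {n m : ℕ} (a : Fin n → ℤ) (u : Fin m → ℤ) : Decidable (ContainsPattern a u) := by
  unfold ContainsPattern; infer_instance

/-- A permutation is separable if it avoids `3142` and `2413`. -/
def IsSeparableA {n : ℕ} (w : Equiv.Perm (Fin n)) : Prop :=
  ¬ ContainsPattern (permWord w) ![3, 1, 4, 2] ∧
  ¬ ContainsPattern (permWord w) ![2, 4, 1, 3]

instance {n : ℕ} (w : Equiv.Perm (Fin n)) : Decidable (IsSeparableA w) := by
  unfold IsSeparableA; infer_instance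

/-- A signed permutation is separable if it avoids the six signed patterns below. -/
def IsSeparableB {n : ℕ} (w : SignedPerm n) : Prop :=
  ¬ ContainsPattern w.word ![-2, 1] ∧
  ¬ ContainsPattern w.word ![2, -1] ∧
  ¬ ContainsPattern w.word ![3, 1, 4, 2] ∧
  ¬ ContainsPattern w.word ![2, 4, 1, 3] ∧
  ¬ ContainsPattern w.word ![-3, -1, -4, -2] ∧
  ¬ ContainsPattern w.word ![-2, -4, -1, -3]

instance {n : ℕ} (w : SignedPerm n) : Decidable (IsSeparableB w) := by
  unfold IsSeparableB; infer_instance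

/-- The set `K(S_n)` of separable permutations. -/
def sepA (n : ℕ) : Finset (Equiv.Perm (Fin n)) := Finset.univ.filter IsSeparableA

/-- The set `K(B_n)` of separable signed permutations. -/
noncomputable def sepB (n : ℕ) : Finset (SignedPerm n) := Finset.univ.filter IsSeparableB

/-- A word `w₁ ⋯ w_n` with all letters at positions outside `[1, n]` equal to `+∞`
(so `w₀ = w_{n+1} = +∞`): the type-A convention. -/
def extendA {n : ℕ} (a : Fin n → ℤ) (i : ℤ) : WithTop ℤ :=
  if h : 1 ≤ i ∧ i ≤ n then ((a ⟨(i - 1).toNat, by omega⟩ : ℤ) : WithTop ℤ) else ⊤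

/-- A word `w₁ ⋯ w_n` with `w₀ = 0` and `w_{-1} = w_{n+1} = +∞`: the type-B convention. -/
def extendB {n : ℕ} (a : Fin n → ℤ) (i : ℤ) : WithTop ℤ :=
  if i = 0 then 0 else extendA a i

/-- The set of A-descents `i ∈ [1, n]`. -/
noncomputable def DesA {n : ℕ} (w : Equiv.Perm (Fin n)) : Finset ℤ :=
  (Finset.Icc 1 (n : ℤ)).filter fun i =>
    extendA (permWord w) i > extendA (permWord w) (i + 1)

/-- The set of double A-descents `i ∈ [1, n]`. -/
noncomputable def DDesA {n : ℕ} (w : Equiv.Perm (Fin n)) : Finset ℤ :=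
  (Finset.Icc 1 (n : ℤ)).filter fun i =>
    extendA (permWord w) (i - 1) > extendA (permWord w) i ∧
    extendA (permWord w) i > extendA (permWord w) (i + 1)

/-- The set of B-descents `i ∈ [0, n]`. -/
noncomputable def DesB {n : ℕ} (w : SignedPerm n) : Finset ℤ :=
  (Finset.Icc 0 (n : ℤ)).filter fun i =>
    extendB w.word i > extendB w.word (i + 1)

/-- The set of double B-descents `i ∈ [0, n]`. -/
noncomputable def DDesB {n : ℕ} (w : SignedPerm n) : Finset ℤ :=
  (Finset.Icc 0 (n : ℤ)).filter fun i =>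
    extendB w.word (i - 1) > extendB w.word i ∧
    extendB w.word i > extendB w.word (i + 1)

/-- `S_n(t) = ∑_{w ∈ K(S_n)} t^{des_A(w)}`. -/
noncomputable def descentPolyA (n : ℕ) : ℤ[X] := ∑ w ∈ sepA n, X ^ (DesA w).card

/-- `B_n(t) = ∑_{w ∈ K(B_n)} t^{des_B(w)}`. -/
noncomputable def descentPolyB (n : ℕ) : ℤ[X] := ∑ w ∈ sepB n, X ^ (DesB w).card

/-- The number of `w ∈ K(S_n)` with no double A-descent and exactly `k` A-descents. -/
noncomputable def gammaA (n k : ℕ) : ℕ :=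
  ((sepA n).filter fun w => (DDesA w).card = 0 ∧ (DesA w).card = k).card

/-- The number of `w ∈ K(B_n)` with no double B-descent and exactly `k` B-descents. -/
noncomputable def gammaB (n k : ℕ) : ℕ :=
  ((sepB n).filter fun w => (DDesB w).card = 0 ∧ (DesB w).card = k).card

/-- `p` is γ-positive with centre of symmetry `d / 2`: it is a combination of the polynomials
`t^k (1 + t)^(d - 2k)`, `0 ≤ k ≤ ⌊d/2⌋`, with non-negative coefficients. -/
def IsGammaPositive (d : ℕ) (p : ℤ[X]) : Prop :=
  ∃ γ : ℕ → ℤ, (∀ k, 0 ≤ γ k) ∧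
    p = ∑ k ∈ Finset.range (d / 2 + 1), C (γ k) * X ^ k * (1 + X) ^ (d - 2 * k)

/-- `p` has degree `d` and its coefficient sequence `p₀, …, p_d` reads the same backwards. -/
def IsPalindromic (d : ℕ) (p : ℤ[X]) : Prop :=
  p.natDegree = d ∧ ∀ i ≤ d, p.coeff i = p.coeff (d - i)

/-- The coefficients of `p` weakly increase up to some index and weakly decrease after it. -/
def IsUnimodal (p : ℤ[X]) : Prop :=
  ∃ m ≤ p.natDegree, (∀ i j, i ≤ j → j ≤ m → p.coeff i ≤ p.coeff j) ∧
    (∀ i j, m ≤ i → i ≤ j → j ≤ p.natDegree → p.coeff j ≤ p.coeff i)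

/-! Two independent facts give the theorem.

From signed to unsigned: standardizing the word `0 w₁ ⋯ w_n` is a bijection from `K(B_n)` to
`K(S_{n+1})`. The type-B conventions at the ends are the type-A conventions for this longer word, so
descents and double descents are preserved. Avoiding the two patterns of length 2 means that letters
of opposite signs increase in absolute value. The relative order of `0 w₁ ⋯ w_n` therefore
determines the order of the absolute values, and so `w`. Conversely, given a separable permutation,
the letters below the first one become negative, and avoidance of 3142 and 2413 makes the candidate
order of absolute values transitive. This is `SignedPerm.isSeparableB_iff`,
`SignedPerm.toPerm_injOn`, `SignedPerm.exists_toPerm_eq` and `sum_sepB`.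

The γ-expansion of `S_{n+1}(t)`: give valleys, peaks, double descents and double ascents the weights
1, t, u, v. A separable word of length at least 2 is a direct sum or a skew sum, never both, and its
first indecomposable summand is unique. The weight of a sum factors once the comparisons at both
ends are recorded, so the series for the four boundary conditions satisfy a small algebraic system.
Elimination gives A = x + x(u+v)A + txA² + tA³, which determines A and involves u and v only through
u + v (`sum_sepLists_eq`). The choice (u, v) = (t, 1) counts descents. The choice (0, 1 + t) kills
the words with a double descent and gives t^k (1+t)^(n-2k) to every other word, k being its number
of descents.

Palindromicity and unimodality follow because all t^k (1+t)^(n-2k) are symmetric and unimodal about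
n/2, and the constant coefficient is positive. -/

/-! ### Separable words as direct and skew sums -/

/-- `Below true x y` means `x < y`, and `Below false x y` means `y < x`. -/
def Below : Bool → ℕ → ℕ → Prop
  | true, x, y => x < y
  | false, x, y => y < x

theorem Below.trans {r : Bool} {x y z : ℕ} (h : Below r x y) (h' : Below r y z) :
    Below r x z := by
  cases r <;> simp only [Below] at * <;> omega

theorem Below.ne {r : Bool} {x y : ℕ} (h : Below r x y) : x ≠ y := by
  cases r <;> simp only [Below] at * <;> omega

theorem Below.swap {r : Bool} {x y : ℕ} (h : Below r x y) : Below (!r) y x := by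
  cases r <;> exact h

theorem below_of_not {r : Bool} {x y : ℕ} (h : ¬ Below r x y) (hne : x ≠ y) : Below r y x := by
  cases r <;> simp only [Below] at * <;> omega

/-- A list avoids the patterns `3142` and `2413`. -/
def SepList (l : List ℕ) : Prop :=
  ∀ a b c d, List.Sublist [a, b, c, d] l →
    ¬ (b < d ∧ d < a ∧ a < c) ∧ ¬ (c < a ∧ a < d ∧ d < b)

theorem sepList_iff {l : List ℕ} : SepList l ↔ ∀ r a b c d, List.Sublist [a, b, c, d] l →
    ¬ (Below r b d ∧ Below r d a ∧ Below r a c) := by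
  constructor
  · intro h r a b c d hl
    have := h a b c d hl
    cases r <;> simp only [Below] <;> omega
  · intro h a b c d hl
    have h1 := h true a b c d hl
    have h2 := h false a b c d hl
    simp only [Below] at h1 h2
    omega

theorem SepList.sublist {l l' : List ℕ} (h : SepList l) (hl : List.Sublist l' l) : SepList l' :=
  fun a b c d hs => h a b c d (hs.trans hl)

/-- Every letter of the first list is below every letter of the second. -/
def AllBelow (r : Bool) (l₁ l₂ : List ℕ) : Prop := ∀ x ∈ l₁, ∀ y ∈ l₂, Below r x y

/-- A separable list with at least two letters is a direct sum or a skew sum. -/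
theorem SepList.exists_split {l : List ℕ} (hs : SepList l) (hn : l.Nodup) (hl : 2 ≤ l.length) :
    ∃ r l₁ l₂, l₁ ≠ [] ∧ l₂ ≠ [] ∧ l = l₁ ++ l₂ ∧ AllBelow r l₁ l₂ := by
  classical
  induction l with
  | nil => simp at hl
  | cons x l ih =>
    rw [List.nodup_cons] at hn
    rcases l with _ | ⟨y, _ | ⟨z, l⟩⟩
    · simp at hl
    · have hxy : x ≠ y := by simpa using hn.1
      by_cases h : x < y
      · exact ⟨true, [x], [y], by simp, by simp, rfl, by simpa [AllBelow, Below] using h⟩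
      · exact ⟨false, [x], [y], by simp, by simp, rfl, by
          simp only [AllBelow, Below, List.mem_singleton]; omega⟩
    · obtain ⟨r, l₁, l₂, h1, h2, he, hb⟩ :=
        ih (hs.sublist (List.sublist_cons_self _ _)) hn.2 (by simp)
      rw [he] at hs hn ⊢
      clear ih he hl
      -- Here `l₂ = p ++ q`, where `p` is the longest prefix of letters on the same side of `x` as
      -- `l₁` would be in a sum. Either `q` is empty and `x` splits off alone, or the cut moves to
      -- the start of `q`.
      have hpq := List.takeWhile_append_dropWhile (p := fun y => decide (Below r y x)) (l := l₂)
      have hp : ∀ y ∈ l₂.takeWhile (fun y => decide (Below r y x)), Below r y x := by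
        intro y hy
        simpa using List.mem_takeWhile_imp hy
      have hq0 : ∀ z q', l₂.dropWhile (fun y => decide (Below r y x)) = z :: q' →
          ¬ Below r z x := by
        intro z q' h
        have := List.head_dropWhile_not (fun y => decide (Below r y x)) (l := l₂) (by simp [h])
        simpa [h] using this
      generalize l₂.takeWhile (fun y => decide (Below r y x)) = p at *
      generalize l₂.dropWhile (fun y => decide (Below r y x)) = q at *
      subst hpq
      rcases q with _ | ⟨z, q⟩
      · refine ⟨!r, [x], l₁ ++ p, by simp, by simp [h1], by simp, ?_⟩
        intro x' hx' y hy
        rw [List.mem_singleton] at hx'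
        subst hx'
        apply Below.swap
        rw [List.append_nil] at hb h2
        rcases List.mem_append.1 hy with hy | hy
        · obtain ⟨w, hw⟩ := List.exists_mem_of_ne_nil _ h2
          exact (hb y hy w hw).trans (hp w hw)
        · exact hp y hy
      · have hxz : Below r x z := below_of_not (hq0 z q rfl) (by
          rintro rfl
          exact hn.1 (by simp))
        have hq : ∀ y ∈ z :: q, Below r x y := by
          intro y hy
          rcases List.mem_cons.1 hy with rfl | hy
          · exact hxz
          · by_contra hxy
            have hyx : Below r y x := below_of_not hxy (by
              rintro rfl
              exact hn.1 (by simp [hy]))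
            -- A letter `y` after `z` on the wrong side of `x` gives, with any `o` in `l₁`, the
            -- subword `x o z y`: a 3142 if `r = true`, a 2413 if `r = false`.
            obtain ⟨o, ho⟩ := List.exists_mem_of_ne_nil _ h1
            refine sepList_iff.1 hs r x o z y ?_
              ⟨hb o ho y (by simp [hy]), hyx, hxz⟩
            refine List.Sublist.cons_cons x ?_
            refine List.Sublist.append (l₁ := [o]) (l₂ := l₁) (List.singleton_sublist.2 ho) ?_
            refine List.Sublist.trans ?_ (List.sublist_append_right p _)
            exact List.Sublist.cons_cons z (List.singleton_sublist.2 hy)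
        refine ⟨r, x :: (l₁ ++ p), z :: q, by simp, by simp, by simp, ?_⟩
        intro a ha y hy
        rcases List.mem_cons.1 ha with rfl | ha
        · exact hq y hy
        · rcases List.mem_append.1 ha with ha | ha
          · exact hb a ha y (List.mem_append_right _ hy)
          · exact (hp a ha).trans (hq y hy)

/-- A direct sum or a skew sum of separable lists is separable. -/
theorem SepList.append {r : Bool} {l₁ l₂ : List ℕ} (h₁ : SepList l₁) (h₂ : SepList l₂)
    (h : AllBelow r l₁ l₂) : SepList (l₁ ++ l₂) := by
  intro a b c d hl
  obtain ⟨k₁, k₂, he, hk₁, hk₂⟩ := List.sublist_append_iff.1 hl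
  have h' : AllBelow r k₁ k₂ := fun x hx y hy => h x (hk₁.subset hx) y (hk₂.subset hy)
  clear h hl
  rcases k₁ with _ | ⟨a', _ | ⟨b', _ | ⟨c', _ | ⟨d', k₁⟩⟩⟩⟩
  · simp only [List.nil_append] at he
    subst he
    exact h₂ _ _ _ _ hk₂
  all_goals
    simp only [List.cons_append, List.nil_append, List.cons.injEq] at he
  · obtain ⟨rfl, rfl⟩ := he
    cases r <;> simp [AllBelow, Below] at h' <;> omega
  · obtain ⟨rfl, rfl, rfl⟩ := he
    cases r <;> simp [AllBelow, Below] at h' <;> omega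
  · obtain ⟨rfl, rfl, rfl, rfl⟩ := he
    cases r <;> simp [AllBelow, Below] at h' <;> omega
  · obtain ⟨rfl, rfl, rfl, rfl, he⟩ := he
    obtain ⟨rfl, rfl⟩ := List.append_eq_nil_iff.1 he.symm
    exact h₁ _ _ _ _ hk₁

theorem SepList.map_add {l : List ℕ} (h : SepList l) (k : ℕ) : SepList (l.map (· + k)) := by
  intro a b c d hl
  obtain ⟨l', hl', he⟩ := List.sublist_map_iff.1 hl
  rcases l' with _ | ⟨a', _ | ⟨b', _ | ⟨c', _ | ⟨d', _ | ⟨e', l'⟩⟩⟩⟩⟩ <;> simp at he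
  have := h _ _ _ _ hl'
  omega

theorem SepList.of_map_add {l : List ℕ} {k : ℕ} (h : SepList (l.map (· + k))) : SepList l := by
  intro a b c d hl
  have := h _ _ _ _ (hl.map (· + k))
  simp only at this
  omega

/-! ### Indecomposable first summands -/

/-- A list is not a sum of two non-empty lists: direct sums for `r = true`, skew sums for
`r = false`. -/
def Indec (r : Bool) (l : List ℕ) : Prop :=
  ∀ l₁ l₂, l₁ ≠ [] → l₂ ≠ [] → l = l₁ ++ l₂ → ¬ AllBelow r l₁ l₂

/-- In a direct sum the first letter is smaller than the last one, in a skew sum it is larger; no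
word is both. -/
theorem indec_of_not_indec {r : Bool} {l : List ℕ} (h : ¬ Indec r l) : Indec (!r) l := by
  simp only [Indec, not_forall, not_not] at h
  obtain ⟨l₁, l₂, h1, h2, rfl, hb⟩ := h
  intro k₁ k₂ hk1 hk2 he hb'
  obtain ⟨x, l₁', rfl⟩ := List.exists_cons_of_ne_nil h1
  obtain ⟨x', k₁', rfl⟩ := List.exists_cons_of_ne_nil hk1
  have hx : x = x' := by simpa using (List.cons.inj he).1
  subst hx
  have hl := List.getLast_append_of_right_ne_nil (x :: l₁') l₂ h2
  have hk := List.getLast_append_of_right_ne_nil (x :: k₁') k₂ hk2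
  have e : l₂.getLast h2 = k₂.getLast hk2 := by
    rw [← hl, ← hk]; simp only [he]
  have a1 := hb x (by simp) _ (List.getLast_mem h2)
  have a2 := hb' x (by simp) _ (List.getLast_mem hk2)
  rw [e] at a1
  cases r <;> simp only [Below, Bool.not_true, Bool.not_false] at a1 a2 <;> omega

/-- As long as the first summand decomposes, its second part can be moved into the other summand. -/
theorem exists_indec_append {r : Bool} {l₁ l₂ : List ℕ} (h1 : l₁ ≠ []) (h2 : l₂ ≠ [])
    (hb : AllBelow r l₁ l₂) :
    ∃ k₁ k₂, k₁ ≠ [] ∧ k₂ ≠ [] ∧ l₁ ++ l₂ = k₁ ++ k₂ ∧ AllBelow r k₁ k₂ ∧ Indec r k₁ := by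
  induction hn : l₁.length using Nat.strong_induction_on generalizing l₁ l₂ with
  | _ n ih =>
    by_cases hi : Indec r l₁
    · exact ⟨l₁, l₂, h1, h2, rfl, hb, hi⟩
    · simp only [Indec, not_forall, not_not] at hi
      obtain ⟨m₁, m₂, hm1, hm2, rfl, hm⟩ := hi
      have hlt : m₁.length < n := by
        rw [← hn, List.length_append]
        have := List.length_pos_iff.2 hm2
        omega
      have := ih _ hlt (l₁ := m₁) (l₂ := m₂ ++ l₂) hm1 (by simp [h2]) (by
        intro x hx y hy
        rcases List.mem_append.1 hy with hy | hy
        · exact hm x hx y hy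
        · exact hb x (List.mem_append_left _ hx) y hy) rfl
      simpa using this

/-- A shorter `l₁` would be a proper prefix of `k₁` and would cut it into a sum. Used in both
directions, this makes the first indecomposable summand unique. -/
theorem length_eq_of_indec_append {r : Bool} {l₁ l₂ k₁ k₂ : List ℕ} (h1 : l₁ ≠ [])
    (hb : AllBelow r l₁ l₂) (hk : Indec r k₁) (he : l₁ ++ l₂ = k₁ ++ k₂) :
    k₁.length ≤ l₁.length := by
  by_contra hlt
  rcases List.append_eq_append_iff.1 he with ⟨m, rfl, rfl⟩ | ⟨m, rfl, rfl⟩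
  · refine hk l₁ m h1 ?_ rfl fun x hx y hy => hb x hx y (List.mem_append_left _ hy)
    rintro rfl
    simp at hlt
  · simp at hlt

/-! ### Weights of words -/

section Weight

variable {R : Type*} [CommRing R] (s : Bool → Bool → R)

/-- The weight of a word: the product over its letters of `s p q`, where `p` and `q` say whether the
left and the right neighbours are larger; `a` and `b` are these flags at the two ends. -/
def wordWeight : Bool → List ℕ → Bool → R
  | _, [], _ => 1
  | a, [_], b => s a b
  | a, x :: y :: l, b => s a (decide (x < y)) * wordWeight (decide (y < x)) (y :: l) b

/-- At the junction the comparison is decided by `r` alone, so each block sees a constant boundary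
flag instead of a letter of the other block. -/
theorem wordWeight_append {r : Bool} (a b : Bool) {l₁ l₂ : List ℕ} (h1 : l₁ ≠ []) (h2 : l₂ ≠ [])
    (hb : AllBelow r l₁ l₂) :
    wordWeight s a (l₁ ++ l₂) b = wordWeight s a l₁ r * wordWeight s (!r) l₂ b := by
  induction l₁ generalizing a with
  | nil => exact absurd rfl h1
  | cons x l₁ ih =>
    rcases l₁ with _ | ⟨y, l₁⟩
    · obtain ⟨y, l₂, rfl⟩ := List.exists_cons_of_ne_nil h2
      have := hb x (by simp) y (by simp)
      have e1 : decide (x < y) = r := by cases r <;> simp only [Below] at this <;> simp <;> omega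
      have e2 : decide (y < x) = !r := by cases r <;> simp only [Below] at this <;> simp <;> omega
      simp [wordWeight, e1, e2]
    · have := ih (decide (y < x)) (by simp) (fun z hz w hw => hb z (List.mem_cons_of_mem _ hz) w hw)
      simp only [List.cons_append] at this
      simp only [List.cons_append, wordWeight, this, mul_assoc]

theorem wordWeight_map_add (a b : Bool) (l : List ℕ) (k : ℕ) :
    wordWeight s a (l.map (· + k)) b = wordWeight s a l b := by
  induction l generalizing a with
  | nil => rfl
  | cons x l ih =>
    rcases l with _ | ⟨y, l⟩
    · rfl
    · have := ih (decide (y < x))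
      simp only [List.map_cons] at this
      simp [wordWeight, this]

end Weight

/-! ### Sums of separable permutations of an initial segment -/

/-- The direct sum (`r = true`) or the skew sum (`r = false`) of two words. -/
def joinLists (r : Bool) (l₁ l₂ : List ℕ) : List ℕ :=
  l₁.map (· + bif r then 0 else l₂.length) ++ l₂.map (· + bif r then l₁.length else 0)

/-- The separable words that are permutations of `0, …, n - 1`, for `n ≥ 1`. -/
noncomputable def sepLists (n : ℕ) : Finset (List ℕ) :=
  open Classical in (List.range n).permutations.toFinset.filter fun l => l ≠ [] ∧ SepList l

theorem mem_sepLists {n : ℕ} {l : List ℕ} :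
    l ∈ sepLists n ↔ l.Perm (List.range n) ∧ l ≠ [] ∧ SepList l := by
  simp [sepLists]

theorem length_of_mem_sepLists {n : ℕ} {l : List ℕ} (h : l ∈ sepLists n) : l.length = n := by
  simpa using (mem_sepLists.1 h).1.length_eq

theorem nodup_of_mem_sepLists {n : ℕ} {l : List ℕ} (h : l ∈ sepLists n) : l.Nodup :=
  (mem_sepLists.1 h).1.nodup_iff.2 List.nodup_range

theorem perm_range_iff {n : ℕ} {l : List ℕ} :
    l.Perm (List.range n) ↔ l.Nodup ∧ l.length = n ∧ ∀ x ∈ l, x < n := by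
  constructor
  · intro h
    exact ⟨h.nodup_iff.2 List.nodup_range, by simpa using h.length_eq,
      fun x hx => by simpa using h.subset hx⟩
  · rintro ⟨h1, h2, h3⟩
    refine (List.subperm_of_subset h1 fun x hx => by simpa using h3 x hx).perm_of_length_le ?_
    simp [h2]

theorem allBelow_joinLists {r : Bool} {l₁ l₂ : List ℕ} {i j : ℕ} (h1 : l₁.Perm (List.range i))
    (h2 : l₂.Perm (List.range j)) :
    AllBelow r (l₁.map (· + bif r then 0 else l₂.length))
      (l₂.map (· + bif r then l₁.length else 0)) := by
  obtain ⟨-, e1, b1⟩ := perm_range_iff.1 h1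
  obtain ⟨-, e2, b2⟩ := perm_range_iff.1 h2
  intro x hx y hy
  obtain ⟨x, hx', rfl⟩ := List.mem_map.1 hx
  obtain ⟨y, hy', rfl⟩ := List.mem_map.1 hy
  have := b1 x hx'
  have := b2 y hy'
  cases r <;> simp only [Below, cond_true, cond_false] <;> omega

theorem joinLists_perm {r : Bool} {l₁ l₂ : List ℕ} {i j : ℕ} (h1 : l₁.Perm (List.range i))
    (h2 : l₂.Perm (List.range j)) : (joinLists r l₁ l₂).Perm (List.range (i + j)) := by
  have hb := allBelow_joinLists (r := r) h1 h2
  obtain ⟨n1, e1, b1⟩ := perm_range_iff.1 h1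
  obtain ⟨n2, e2, b2⟩ := perm_range_iff.1 h2
  refine perm_range_iff.2 ⟨?_, by simp [joinLists, e1, e2], ?_⟩
  · refine List.Nodup.append (n1.map fun x y h => by simpa using h)
      (n2.map fun x y h => by simpa using h) fun x hx hy => (hb x hx x hy).ne rfl
  · intro x hx
    rcases List.mem_append.1 hx with hx | hx <;> obtain ⟨x, hx', rfl⟩ := List.mem_map.1 hx
    · have := b1 x hx'
      cases r <;> simp only [cond_true, cond_false] <;> omega
    · have := b2 x hx'
      cases r <;> simp only [cond_true, cond_false] <;> omega

theorem joinLists_mem {r : Bool} {l₁ l₂ : List ℕ} {i j : ℕ} (h1 : l₁ ∈ sepLists i)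
    (h2 : l₂ ∈ sepLists j) : joinLists r l₁ l₂ ∈ sepLists (i + j) := by
  obtain ⟨p1, e1, s1⟩ := mem_sepLists.1 h1
  obtain ⟨p2, e2, s2⟩ := mem_sepLists.1 h2
  exact mem_sepLists.2 ⟨joinLists_perm p1 p2, by simp [joinLists, e1],
    (s1.map_add _).append (s2.map_add _) (allBelow_joinLists p1 p2)⟩

/-- If a permutation of `0, …, n - 1` is cut into the words `l₁` of small letters and `l₂` of large
letters, then `l₁` is a permutation of `0, …, |l₁| - 1`, and `l₂` is a shifted permutation. -/
theorem perm_range_split {n : ℕ} {l₁ l₂ : List ℕ} (h : (l₁ ++ l₂).Perm (List.range n))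
    (hb : AllBelow true l₁ l₂) :
    l₁.Perm (List.range l₁.length) ∧
      ∃ k : List ℕ, l₂ = k.map (· + l₁.length) ∧ k.Perm (List.range l₂.length) := by
  obtain ⟨hn, hl, hlt⟩ := perm_range_iff.1 h
  obtain ⟨n1, n2, -⟩ := List.nodup_append.1 hn
  rw [List.length_append] at hl
  have hmem : ∀ x, x < n → x ∈ l₁ ∨ x ∈ l₂ := fun x hx =>
    List.mem_append.1 (h.mem_iff.2 (List.mem_range.2 hx))
  have h1 : l₁.Perm (List.range l₁.length) := by
    refine perm_range_iff.2 ⟨n1, rfl, fun x hx => ?_⟩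
    -- Everything up to a letter of `l₁` lies in `l₁`, so that letter is less than `l₁.length`.
    have hsub : List.range (x + 1) ⊆ l₁ := by
      intro y hy
      rw [List.mem_range] at hy
      have hxn := hlt x (List.mem_append_left _ hx)
      rcases hmem y (by omega) with h | h
      · exact h
      · have := hb x hx y h
        simp only [Below] at this
        omega
    have := (List.subperm_of_subset List.nodup_range hsub).length_le
    simpa using this
  have hge : ∀ y ∈ l₂, l₁.length ≤ y := by
    intro y hy
    by_contra hlt'
    have hy1 : y ∈ l₁ := h1.mem_iff.2 (List.mem_range.2 (by omega))
    exact (hb y hy1 y hy).ne rfl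
  have he : l₂ = (l₂.map (· - l₁.length)).map (· + l₁.length) := by
    rw [List.map_map]
    conv_lhs => rw [← List.map_id l₂]
    refine List.map_congr_left fun y hy => ?_
    have := hge y hy
    simp only [id, Function.comp]
    omega
  refine ⟨h1, _, he, perm_range_iff.2 ⟨?_, by simp, ?_⟩⟩
  · rw [he] at n2
    exact n2.of_map _
  · intro x hx
    obtain ⟨y, hy, rfl⟩ := List.mem_map.1 hx
    have := hge y hy
    have := hlt y (List.mem_append_right _ hy)
    omega

theorem exists_joinLists_eq {r : Bool} {n : ℕ} {l₁ l₂ : List ℕ} (h : l₁ ++ l₂ ∈ sepLists n)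
    (h1 : l₁ ≠ []) (h2 : l₂ ≠ []) (hb : AllBelow r l₁ l₂) :
    ∃ k₁ ∈ sepLists l₁.length, ∃ k₂ ∈ sepLists l₂.length,
      l₁ = k₁.map (· + bif r then 0 else l₂.length) ∧
      l₂ = k₂.map (· + bif r then l₁.length else 0) := by
  obtain ⟨hp, -, hs⟩ := mem_sepLists.1 h
  have s1 := hs.sublist (List.sublist_append_left _ _)
  have s2 := hs.sublist (List.sublist_append_right _ _)
  cases r with
  | true =>
    obtain ⟨p1, k, hk, p2⟩ := perm_range_split hp hb
    refine ⟨l₁, mem_sepLists.2 ⟨p1, h1, s1⟩, k, mem_sepLists.2 ⟨p2, ?_, ?_⟩, by simp, hk⟩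
    · rintro rfl; exact h2 hk
    · rw [hk] at s2; exact s2.of_map_add
  | false =>
    obtain ⟨p1, k, hk, p2⟩ := perm_range_split (List.perm_append_comm.trans hp)
      (fun x hx y hy => hb y hy x hx)
    refine ⟨k, mem_sepLists.2 ⟨p2, ?_, ?_⟩, l₂, mem_sepLists.2 ⟨p1, h2, s2⟩, hk, by simp⟩
    · rintro rfl; exact h1 hk
    · rw [hk] at s1; exact s1.of_map_add

/-! ### Generating functions and their linear relations -/

section GeneratingFunctions

variable {R : Type*} [CommRing R] (s : Bool → Bool → R)

/-- The generating function of separable words by length and weight. -/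
noncomputable def sepSeries (a b : Bool) : PowerSeries R :=
  PowerSeries.mk fun n => ∑ l ∈ sepLists n, wordWeight s a l b

open Classical in
/-- The generating function of the separable words that are not sums. -/
noncomputable def indecSeries (r a b : Bool) : PowerSeries R :=
  PowerSeries.mk fun n => ∑ l ∈ (sepLists n).filter (Indec r), wordWeight s a l b

-- `joinLists` is a bijection from pairs (indecomposable word, word) to decomposable words, and the
-- weight is multiplicative along it.
open Classical in
theorem sum_not_indec (r a b : Bool) (n : ℕ) :
    ∑ l ∈ (sepLists n).filter (fun l => ¬ Indec r l), wordWeight s a l b =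
      ∑ p ∈ Finset.HasAntidiagonal.antidiagonal n,
        (∑ l ∈ (sepLists p.1).filter (Indec r), wordWeight s a l r) *
          ∑ l ∈ sepLists p.2, wordWeight s (!r) l b := by
  simp only [Finset.sum_mul_sum, ← Finset.sum_product']
  rw [Finset.sum_sigma']
  symm
  refine Finset.sum_nbij (fun x => joinLists r x.2.1 x.2.2) ?_ ?_ ?_ ?_
  · rintro ⟨⟨i, j⟩, l₁, l₂⟩ h
    simp only [Finset.mem_sigma, Finset.HasAntidiagonal.mem_antidiagonal, Finset.mem_product,
      Finset.mem_filter] at h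
    obtain ⟨rfl, ⟨h1, hi⟩, h2⟩ := h
    refine Finset.mem_filter.2 ⟨joinLists_mem h1 h2, fun hn => ?_⟩
    refine hn _ _ ?_ ?_ rfl (allBelow_joinLists (mem_sepLists.1 h1).1 (mem_sepLists.1 h2).1)
    · simpa using (mem_sepLists.1 h1).2.1
    · simpa using (mem_sepLists.1 h2).2.1
  · rintro ⟨⟨i, j⟩, l₁, l₂⟩ h ⟨⟨i', j'⟩, l₁', l₂'⟩ h' he
    simp only [Finset.coe_sigma, Set.mem_sigma_iff, Finset.mem_coe, Finset.HasAntidiagonal.mem_antidiagonal,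
      Finset.mem_product, Finset.mem_filter] at h h'
    obtain ⟨e, ⟨h1, hi⟩, h2⟩ := h
    obtain ⟨e', ⟨h1', hi'⟩, h2'⟩ := h'
    have n1 := length_of_mem_sepLists h1
    have n2 := length_of_mem_sepLists h2
    have n1' := length_of_mem_sepLists h1'
    have n2' := length_of_mem_sepLists h2'
    have hb := allBelow_joinLists (r := r) (mem_sepLists.1 h1).1 (mem_sepLists.1 h2).1
    have hb' := allBelow_joinLists (r := r) (mem_sepLists.1 h1').1 (mem_sepLists.1 h2').1
    have hind : ∀ {l : List ℕ} {k : ℕ}, Indec r l → Indec r (l.map (· + k)) := by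
      intro l k hl k₁ k₂ hk1 hk2 hk hab
      obtain ⟨m₁, m₂, rfl, rfl, rfl⟩ := List.map_eq_append_iff.1 hk
      refine hl m₁ m₂ (by simpa using hk1) (by simpa using hk2) rfl fun x hx y hy => ?_
      have := hab _ (List.mem_map_of_mem hx) _ (List.mem_map_of_mem hy)
      cases r <;> simpa only [Below, Nat.add_lt_add_iff_right] using this
    -- Each of the two first summands is at most as long as the other, so the cuts coincide.
    have l1 := length_eq_of_indec_append (by simpa using (mem_sepLists.1 h1).2.1) hb
      (hind hi') he
    have l2 := length_eq_of_indec_append (by simpa using (mem_sepLists.1 h1').2.1) hb'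
      (hind hi) he.symm
    simp only [List.length_map] at l1 l2
    have hii : i = i' := by omega
    have hjj : j = j' := by omega
    subst hii hjj
    obtain ⟨e1, e2⟩ := List.append_inj he (by simp; omega)
    rw [n1, n1'] at e2
    rw [n2, n2'] at e1
    have inj : ∀ k : ℕ, Function.Injective (fun x : ℕ => x + k) := fun k x y h => by simpa using h
    obtain rfl : l₁ = l₁' := List.map_injective_iff.2 (inj _) e1
    obtain rfl : l₂ = l₂' := List.map_injective_iff.2 (inj _) e2
    rfl
  · intro l hl
    simp only [Finset.mem_coe, Finset.mem_filter, Indec, not_forall, not_not] at hl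
    obtain ⟨hl, l₁, l₂, h1, h2, rfl, hb⟩ := hl
    obtain ⟨k₁, k₂, hk1, hk2, he, hb', hi⟩ := exists_indec_append h1 h2 hb
    rw [he] at hl
    obtain ⟨m₁, hm1, m₂, hm2, e1, e2⟩ := exists_joinLists_eq hl hk1 hk2 hb'
    refine ⟨⟨(k₁.length, k₂.length), m₁, m₂⟩, ?_, ?_⟩
    · simp only [Finset.coe_sigma, Set.mem_sigma_iff, Finset.mem_coe, Finset.HasAntidiagonal.mem_antidiagonal,
        Finset.mem_product, Finset.mem_filter]
      refine ⟨by simpa using length_of_mem_sepLists hl, ⟨hm1, ?_⟩, hm2⟩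
      intro p₁ p₂ hp1 hp2 hp hab
      refine hi (p₁.map (· + _)) (p₂.map (· + _)) (by simpa using hp1) (by simpa using hp2)
        (by rw [e1, hp, List.map_append]) fun x hx y hy => ?_
      obtain ⟨x, hx', rfl⟩ := List.mem_map.1 hx
      obtain ⟨y, hy', rfl⟩ := List.mem_map.1 hy
      have := hab x hx' y hy'
      cases r <;> simpa only [Below, Nat.add_lt_add_iff_right] using this
    · simp only [joinLists, length_of_mem_sepLists hm1, length_of_mem_sepLists hm2]
      rw [he]
      exact congrArg₂ _ e1.symm e2.symm
  · rintro ⟨⟨i, j⟩, l₁, l₂⟩ h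
    simp only [Finset.mem_sigma, Finset.HasAntidiagonal.mem_antidiagonal, Finset.mem_product,
      Finset.mem_filter] at h
    obtain ⟨rfl, ⟨h1, hi⟩, h2⟩ := h
    simp only [joinLists]
    rw [wordWeight_append s a b (by simpa using (mem_sepLists.1 h1).2.1)
      (by simpa using (mem_sepLists.1 h2).2.1)
      (allBelow_joinLists (mem_sepLists.1 h1).1 (mem_sepLists.1 h2).1),
      wordWeight_map_add, wordWeight_map_add]

/-- A separable word is either not a sum, or the sum of a word which is not a sum and a word. -/
theorem sepSeries_eq (r a b : Bool) :
    sepSeries s a b =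
      indecSeries s r a b + indecSeries s r a r * sepSeries s (!r) b := by
  classical
  ext n
  simp only [sepSeries, indecSeries, PowerSeries.coeff_mk, map_add, PowerSeries.coeff_mul]
  rw [← Finset.sum_filter_add_sum_filter_not (sepLists n) (Indec r), sum_not_indec]

theorem sepLists_zero : sepLists 0 = ∅ := by
  ext l
  simp only [mem_sepLists, List.range_zero, List.perm_nil]
  simp only [Finset.notMem_empty, iff_false]
  tauto

theorem sepLists_one : sepLists 1 = {[0]} := by
  ext l
  simp only [mem_sepLists, List.range_one, List.perm_singleton, Finset.mem_singleton]
  refine ⟨fun h => h.1, ?_⟩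
  rintro rfl
  refine ⟨rfl, by simp, fun a b c d h => ?_⟩
  have := h.length_le
  simp at this

theorem indec_singleton (r : Bool) (x : ℕ) : Indec r [x] := by
  intro l₁ l₂ h1 h2 he
  have := congrArg List.length he
  have := List.length_pos_iff.2 h1
  have := List.length_pos_iff.2 h2
  simp at *
  omega

/-- A separable word with at least two letters is either a direct sum or a skew sum. -/
theorem sepSeries_add_eq (a b : Bool) :
    sepSeries s a b + PowerSeries.X * PowerSeries.C (s a b) =
      indecSeries s true a b + indecSeries s false a b := by
  classical
  ext n
  rcases n with _ | _ | n
  · simp [sepSeries, indecSeries, sepLists_zero]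
  -- The one-letter word is indecomposable in both senses; the term `X * C (s a b)` makes up for its
  -- being counted twice.
  · have : ∀ r, ({[0]} : Finset (List ℕ)).filter (Indec r) = {[0]} := fun r => by
      simp [Finset.filter_singleton, indec_singleton]
    simp only [zero_add, sepSeries, indecSeries, map_add, PowerSeries.coeff_mk, sepLists_one, this]
    rw [← zero_add 1, PowerSeries.coeff_succ_X_mul]
    simp [wordWeight]
  · have hX : PowerSeries.coeff (n + 1 + 1) (PowerSeries.X * PowerSeries.C (s a b)) = 0 := by
      rw [PowerSeries.coeff_succ_X_mul, PowerSeries.coeff_C]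
      simp
    simp only [map_add, hX, add_zero, sepSeries, indecSeries, PowerSeries.coeff_mk]
    rw [← Finset.sum_filter_add_sum_filter_not (sepLists _) (Indec true)]
    congr 2
    refine Finset.filter_congr fun l hl => ?_
    refine ⟨fun h => indec_of_not_indec h, fun h h' => ?_⟩
    obtain ⟨r, l₁, l₂, h1, h2, he, hb⟩ := (mem_sepLists.1 hl).2.2.exists_split
      (nodup_of_mem_sepLists hl) (by rw [length_of_mem_sepLists hl]; omega)
    cases r
    · exact h _ _ h1 h2 he hb
    · exact h' _ _ h1 h2 he hb

theorem constantCoeff_sepSeries (a b : Bool) :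
    PowerSeries.constantCoeff (sepSeries s a b) = 0 := by
  simp [sepSeries, ← PowerSeries.coeff_zero_eq_constantCoeff_apply, sepLists_zero]

theorem constantCoeff_indecSeries (r a b : Bool) :
    PowerSeries.constantCoeff (indecSeries s r a b) = 0 := by
  simp [indecSeries, ← PowerSeries.coeff_zero_eq_constantCoeff_apply, sepLists_zero]

end GeneratingFunctions

/-! ### The cubic functional equation -/

/-- The weight of a letter: `1` for valleys, `t` for peaks, `u` for double descents and `v` for
double ascents. -/
def letterWeight {R : Type*} [One R] (t u v : R) : Bool → Bool → R
  | true, true => 1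
  | true, false => u
  | false, true => v
  | false, false => t

theorem isUnit_of_constantCoeff_eq_one {R : Type*} [CommRing R] {f : PowerSeries R}
    (h : PowerSeries.constantCoeff f = 1) : IsUnit f :=
  PowerSeries.isUnit_iff_constantCoeff.2 (by simp [h])

theorem sepSeries_functional_equation {R : Type*} [CommRing R] (t u v : R) :
    sepSeries (letterWeight t u v) true true =
      PowerSeries.X + PowerSeries.X * PowerSeries.C (u + v) *
        sepSeries (letterWeight t u v) true true +
      PowerSeries.C t * PowerSeries.X * sepSeries (letterWeight t u v) true true ^ 2 +
      PowerSeries.C t * sepSeries (letterWeight t u v) true true ^ 3 := by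
  set s := letterWeight t u v with hs
  have e1 := sepSeries_eq s true true true
  have e2 := sepSeries_eq s true true false
  have e3 := sepSeries_eq s true false true
  have e4 := sepSeries_eq s true false false
  have f1 := sepSeries_eq s false true true
  have f2 := sepSeries_eq s false true false
  have f3 := sepSeries_eq s false false true
  have f4 := sepSeries_eq s false false false
  have g1 := sepSeries_add_eq s true true
  have g2 := sepSeries_add_eq s true false
  have g3 := sepSeries_add_eq s false true
  have g4 := sepSeries_add_eq s false false
  have k1 := constantCoeff_sepSeries s true false
  have k2 := constantCoeff_sepSeries s false true
  have k3 := constantCoeff_indecSeries s false true false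
  have k4 := constantCoeff_indecSeries s true false true
  simp only [Bool.not_true, Bool.not_false] at e1 e2 e3 e4 f1 f2 f3 f4
  rw [hs] at g1 g2 g3 g4
  simp only [letterWeight, ← hs, map_one, mul_one] at g1 g2 g3 g4
  rw [map_add]
  generalize sepSeries s true true = a at *
  generalize sepSeries s true false = b at *
  generalize sepSeries s false true = c at *
  generalize sepSeries s false false = d at *
  generalize indecSeries s true true true = i1 at *
  generalize indecSeries s true true false = m1 at *
  generalize indecSeries s true false true = i2 at *
  generalize indecSeries s true false false = m2 at *
  generalize indecSeries s false true true = n1 at *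
  generalize indecSeries s false true false = j at *
  generalize indecSeries s false false true = n2 at *
  generalize indecSeries s false false false = k at *
  generalize (PowerSeries.X : PowerSeries R) = x at *
  generalize PowerSeries.C t = t at *
  generalize PowerSeries.C u = u at *
  generalize PowerSeries.C v = v at *
  -- All series involved have zero constant term, so these factors can be cancelled.
  have hb : IsUnit (1 + b) := isUnit_of_constantCoeff_eq_one (by simp [k1])
  have hc : IsUnit (1 + c) := isUnit_of_constantCoeff_eq_one (by simp [k2])
  have hji : IsUnit (1 - j - i2) := isUnit_of_constantCoeff_eq_one (by simp [k3, k4])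
  have hp : (1 - j) * (1 + b) = 1 := by linear_combination f2
  have hq : (1 - i2) * (1 + c) = 1 := by linear_combination e3
  have hi1 : i1 = a * (1 - i2) := hc.mul_right_cancel (by linear_combination -e1 - a * hq)
  have hk : k = d * (1 - j) := hb.mul_right_cancel (by linear_combination -f4 - d * hp)
  -- The remaining unknowns are `a`, `d`, `j` and `i2`. The same factor relates `a` to `x` and `d`
  -- to `x * t`, whence `d = t * a`.
  have ha : x = a * (1 - j - i2) := by linear_combination g1 - f1 + hi1
  have hd' : x * t = d * (1 - j - i2) := by linear_combination g4 - e4 + hk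
  have hd : d = t * a := hji.mul_right_cancel (by linear_combination -hd' + t * ha)
  have hj : x * u = j - a * d * (1 - i2) := by linear_combination g2 - e2 - d * hi1
  have hv : x * v = i2 - a * d * (1 - j) := by linear_combination g3 - f3 - a * hk
  subst hd
  -- The sum of `hj` and `hv` involves `j` and `i2` only through `j + i2`, which `ha` eliminates
  -- after multiplication by `a`. This is where `u` and `v` merge into `u + v`.
  linear_combination (-a) * hj - a * hv + (-1 - t * a ^ 2) * ha

/-- The difference of the two equations is `a - a'` times a series with constant term 1, equated to
zero. -/
theorem eq_of_functional_equation {R : Type*} [CommRing R] {t w a a' : PowerSeries R}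
    (h : PowerSeries.constantCoeff a = 0) (h' : PowerSeries.constantCoeff a' = 0)
    (e : a = PowerSeries.X + PowerSeries.X * w * a + t * PowerSeries.X * a ^ 2 + t * a ^ 3)
    (e' : a' = PowerSeries.X + PowerSeries.X * w * a' + t * PowerSeries.X * a' ^ 2 + t * a' ^ 3) :
    a = a' := by
  have hu : IsUnit (1 - (PowerSeries.X * w + t * PowerSeries.X * (a + a') +
      t * (a ^ 2 + a * a' + a' ^ 2))) :=
    isUnit_of_constantCoeff_eq_one (by simp [h, h'])
  have := hu.mul_left_eq_zero (a := a - a') |>.1 (by linear_combination e - e')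
  exact sub_eq_zero.1 this

/-- The enumerator depends on the weights of double descents and double ascents only through their
sum. -/
theorem sum_sepLists_eq {R : Type*} [CommRing R] {t u v u' v' : R} (h : u + v = u' + v') (n : ℕ) :
    ∑ l ∈ sepLists n, wordWeight (letterWeight t u v) true l true =
      ∑ l ∈ sepLists n, wordWeight (letterWeight t u' v') true l true := by
  have e := sepSeries_functional_equation t u v
  have e' := sepSeries_functional_equation t u' v'
  rw [← h] at e'
  have := congrArg (PowerSeries.coeff n) (eq_of_functional_equation
    (constantCoeff_sepSeries _ _ _) (constantCoeff_sepSeries _ _ _) e e')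
  simpa only [sepSeries, PowerSeries.coeff_mk] using this

/-! ### Permutations as words, and the γ-expansion in type A -/

/-- The word of a permutation, as a list of letters in `0, …, m - 1`. -/
def permList {m : ℕ} (w : Equiv.Perm (Fin m)) : List ℕ := List.ofFn fun i => (w i : ℕ)

theorem sublist_ofFn_iff {n : ℕ} (g : Fin n → ℕ) (a b c d : ℕ) :
    List.Sublist [a, b, c, d] (List.ofFn g) ↔
      ∃ f : Fin 4 → Fin n, StrictMono f ∧ g (f 0) = a ∧ g (f 1) = b ∧ g (f 2) = c ∧
        g (f 3) = d := by
  rw [List.sublist_iff_exists_fin_orderEmbedding_get_eq]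
  have hn : (List.ofFn g).length = n := List.length_ofFn
  constructor
  · rintro ⟨f, hf⟩
    refine ⟨fun i => Fin.cast hn (f i), fun i j h => ?_, ?_⟩
    · simpa using f.strictMono h
    · have h0 := hf (0 : Fin 4)
      have h1 := hf (1 : Fin 4)
      have h2 := hf (2 : Fin 4)
      have h3 := hf (3 : Fin 4)
      simp only [List.get_ofFn] at h0 h1 h2 h3
      exact ⟨h0.symm, h1.symm, h2.symm, h3.symm⟩
  · rintro ⟨f, hf, h0, h1, h2, h3⟩
    refine ⟨OrderEmbedding.ofStrictMono (fun i : Fin 4 => Fin.cast hn.symm (f i))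
      (fun i j h => by simpa using hf h), fun i => ?_⟩
    change Fin 4 at i
    simp only [List.get_ofFn]
    fin_cases i
    exacts [h0.symm, h1.symm, h2.symm, h3.symm]

/-- For letters of one sign, the three comparisons between consecutive values determine the whole
relative order. -/
theorem containsPattern_3142_iff {n : ℕ} {a : Fin n → ℤ} :
    ContainsPattern a ![3, 1, 4, 2] ↔ ∃ f : Fin 4 → Fin n, StrictMono f ∧ (∀ i, 0 ≤ a (f i)) ∧
      a (f 1) < a (f 3) ∧ a (f 3) < a (f 0) ∧ a (f 0) < a (f 2) := by
  constructor
  · rintro ⟨f, h1, h2, h3⟩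
    have hp : ∀ i, 0 ≤ a (f i) := fun i => by
      have := h2 i
      fin_cases i <;> simp at this ⊢ <;> omega
    have p1 := h3 1 3
    have p2 := h3 3 0
    have p3 := h3 0 2
    simp only [abs_of_nonneg (hp _)] at p1 p2 p3
    refine ⟨f, fun i j => h1 i j, hp, p1.2 ?_, p2.2 ?_, p3.2 ?_⟩ <;> simp
  · rintro ⟨f, h1, hp, p1, p2, p3⟩
    refine ⟨f, fun i j h => h1 h, fun i => ?_, fun i j => ?_⟩
    · have := hp i
      fin_cases i <;> simp at this ⊢ <;> omega
    · simp only [abs_of_nonneg (hp _)]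
      fin_cases i <;> fin_cases j <;> simp <;> omega

theorem containsPattern_2413_iff {n : ℕ} {a : Fin n → ℤ} :
    ContainsPattern a ![2, 4, 1, 3] ↔ ∃ f : Fin 4 → Fin n, StrictMono f ∧ (∀ i, 0 ≤ a (f i)) ∧
      a (f 2) < a (f 0) ∧ a (f 0) < a (f 3) ∧ a (f 3) < a (f 1) := by
  constructor
  · rintro ⟨f, h1, h2, h3⟩
    have hp : ∀ i, 0 ≤ a (f i) := fun i => by
      have := h2 i
      fin_cases i <;> simp at this ⊢ <;> omega
    have p1 := h3 2 0
    have p2 := h3 0 3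
    have p3 := h3 3 1
    simp only [abs_of_nonneg (hp _)] at p1 p2 p3
    refine ⟨f, fun i j => h1 i j, hp, p1.2 ?_, p2.2 ?_, p3.2 ?_⟩ <;> simp
  · rintro ⟨f, h1, hp, p1, p2, p3⟩
    refine ⟨f, fun i j h => h1 h, fun i => ?_, fun i j => ?_⟩
    · have := hp i
      fin_cases i <;> simp at this ⊢ <;> omega
    · simp only [abs_of_nonneg (hp _)]
      fin_cases i <;> fin_cases j <;> simp <;> omega

/-- A function `a` on `Fin n` has neither a `3142` nor a `2413`, all signs being ignored. -/
def SepFun {n : ℕ} {α : Type*} [LT α] (a : Fin n → α) : Prop :=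
  ∀ f : Fin 4 → Fin n, StrictMono f →
    ¬ (a (f 1) < a (f 3) ∧ a (f 3) < a (f 0) ∧ a (f 0) < a (f 2)) ∧
    ¬ (a (f 2) < a (f 0) ∧ a (f 0) < a (f 3) ∧ a (f 3) < a (f 1))

theorem isSeparableA_iff {n : ℕ} {w : Equiv.Perm (Fin n)} : IsSeparableA w ↔ SepFun w := by
  have hp : ∀ i, 0 ≤ permWord w i := fun i => by unfold permWord; positivity
  have hlt : ∀ i j, permWord w i < permWord w j ↔ w i < w j := fun i j => by
    simp [permWord]
  simp only [IsSeparableA, containsPattern_3142_iff, containsPattern_2413_iff, hp, hlt,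
    implies_true, true_and, SepFun, not_exists, forall_and, not_and]

theorem sepList_permList_iff {n : ℕ} {w : Equiv.Perm (Fin n)} :
    SepList (permList w) ↔ SepFun w := by
  simp only [SepList, permList, sublist_ofFn_iff, SepFun, Fin.lt_def]
  constructor
  · intro h f hf
    exact h _ _ _ _ ⟨f, hf, rfl, rfl, rfl, rfl⟩
  · rintro h a b c d ⟨f, hf, rfl, rfl, rfl, rfl⟩
    exact h f hf

theorem sum_sepA {M : Type*} [AddCommMonoid M] (n : ℕ) (f : List ℕ → M) :
    ∑ w ∈ sepA (n + 1), f (permList w) = ∑ l ∈ sepLists (n + 1), f l := by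
  refine Finset.sum_nbij permList ?_ ?_ ?_ fun _ _ => rfl
  · intro w hw
    have hw : SepFun w := isSeparableA_iff.1 (Finset.mem_filter.1 hw).2
    refine mem_sepLists.2 ⟨perm_range_iff.2 ⟨?_, by simp [permList], ?_⟩, ?_,
      sepList_permList_iff.2 hw⟩
    · exact List.nodup_ofFn.2 fun i j h => w.injective (Fin.ext h)
    · intro x hx
      obtain ⟨i, rfl⟩ := (List.mem_ofFn' _ _).1 hx
      exact (w i).2
    · simp [permList]
  · intro w _ w' _ h
    have := List.ofFn_injective h
    ext i
    exact congrFun this i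
  · intro l hl
    obtain ⟨hp, -, hs⟩ := mem_sepLists.1 hl
    obtain ⟨h1, h2, h3⟩ := perm_range_iff.1 hp
    let g : Fin (n + 1) → Fin (n + 1) := fun i => ⟨l[i], h3 _ (List.getElem_mem _)⟩
    have hg : Function.Injective g := fun i j h => by
      have := congrArg Fin.val h
      simp only [g, Fin.getElem_fin, h1.getElem_inj_iff] at this
      exact Fin.ext this
    let w : Equiv.Perm (Fin (n + 1)) := Equiv.ofBijective g (Finite.injective_iff_bijective.1 hg)
    have hw : permList w = l := by
      refine List.ext_getElem (by simp [permList, h2]) fun i hi hi' => ?_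
      simp [permList, w, g, -List.ofFn_succ]
    refine ⟨w, ?_, hw⟩
    refine Finset.mem_filter.2 ⟨Finset.mem_univ _, isSeparableA_iff.2 ?_⟩
    rw [← sepList_permList_iff, hw]
    exact hs

/-- The list is a window of the sequence `e`, starting at `k + 1`, and each flag becomes a descent
test in `e`. Distinctness of the letters makes "not a descent" an ascent inside the window; the
shift by 1 matches `permWord`. -/
theorem wordWeight_eq_prod {R : Type*} [CommRing R] (s : Bool → Bool → R) (e : ℤ → WithTop ℤ)
    (l : List ℕ) (hl : l ≠ []) (hn : l.Nodup) (k : ℤ)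
    (he : ∀ j (h : j < l.length), e (k + 1 + j) = (((l[j] : ℤ) + 1 : ℤ) : WithTop ℤ)) :
    wordWeight s (decide (e k > e (k + 1))) l
        (!decide (e (k + l.length) > e (k + l.length + 1))) =
      ∏ j ∈ Finset.range l.length,
        s (decide (e (k + j) > e (k + j + 1))) (!decide (e (k + j + 1) > e (k + j + 2))) := by
  induction l generalizing k with
  | nil => exact absurd rfl hl
  | cons x l ih =>
    rcases l with _ | ⟨y, l⟩
    · simp [wordWeight, add_assoc]
    · have ih := ih (by simp) (List.nodup_cons.1 hn).2 (k + 1) (fun j hj => by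
        have := he (j + 1) (by simpa using hj)
        rw [List.getElem_cons_succ] at this
        rw [← this]
        push_cast
        ring_nf)
      have hxy : x ≠ y := fun h => (List.nodup_cons.1 hn).1 (by simp [h])
      have h0 := he 0 (by simp)
      have h1 := he 1 (by simp)
      simp only [Nat.cast_zero, add_zero, Nat.cast_one, List.getElem_cons_zero,
        List.getElem_cons_succ, add_assoc, one_add_one_eq_two] at h0 h1
      rw [List.length_cons, Finset.prod_range_succ', mul_comm, wordWeight]
      have d1 : decide (y < x) = decide (e (k + 1) > e (k + 1 + 1)) := by
        rw [add_assoc, one_add_one_eq_two, h0, h1]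
        simp only [gt_iff_lt, WithTop.coe_lt_coe]
        congr 1
        simp
      have d2 : decide (x < y) = !decide (e (k + 1) > e (k + 1 + 1)) := by
        rw [← d1]
        by_cases h : x < y
        · simp [h, h.le]
        · simp [h]; omega
      rw [d2, d1]
      congr 1
      · simp [add_assoc, one_add_one_eq_two]
      · convert ih using 3 <;> push_cast <;> ring_nf

theorem prod_letterWeight_eq_pow {R : Type*} [CommRing R] (t : R) (D : ℕ → Bool) (m : ℕ) :
    ∏ j ∈ Finset.range m, letterWeight t t 1 (D j) (!D (j + 1)) =
      t ^ ((Finset.range m).filter fun j => D (j + 1)).card := by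
  rw [← Finset.prod_const, Finset.prod_filter]
  refine Finset.prod_congr rfl fun j _ => ?_
  cases D j <;> cases D (j + 1) <;> simp [letterWeight]

/-- Here `r` counts double ascents. Starting from a descent, valleys and peaks alternate, so there
are as many valleys as peaks, plus one when `D m` is not a descent. -/
theorem exists_prod_letterWeight_eq {R : Type*} [CommRing R] (t u v : R) (D : ℕ → Bool) (m : ℕ)
    (h0 : D 0 = true) (hd : ∀ j < m, ¬ (D j = true ∧ D (j + 1) = true)) :
    ∃ r, m = 2 * ((Finset.range m).filter fun j => D (j + 1)).card + r + (bif D m then 0 else 1) ∧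
      ∏ j ∈ Finset.range m, letterWeight t u v (D j) (!D (j + 1)) =
        t ^ ((Finset.range m).filter fun j => D (j + 1)).card * v ^ r := by
  induction m with
  | zero => exact ⟨0, by simp [h0]⟩
  | succ m ih =>
    obtain ⟨r, h1, h2⟩ := ih fun j hj => hd j (by omega)
    have := hd m (by omega)
    rw [Finset.prod_range_succ, h2, Finset.range_add_one, Finset.filter_insert]
    rcases h : D m <;> rcases h' : D (m + 1) <;> simp only [h, h', cond_true, cond_false] at *
    · exact ⟨r + 1, by simp; omega, by simp [letterWeight]; ring⟩
    · exact ⟨r, by simp; omega, by simp [letterWeight]; ring⟩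
    · exact ⟨r, by simp; omega, by simp [letterWeight]⟩
    · simp at this

theorem card_filter_Icc_int (m : ℕ) (p : ℤ → Prop) [DecidablePred p] :
    ((Finset.Icc 1 (m : ℤ)).filter p).card =
      ((Finset.range m).filter fun j : ℕ => p ((j : ℤ) + 1)).card := by
  symm
  refine Finset.card_bij (fun j _ => (j : ℤ) + 1) ?_ ?_ ?_
  · intro j hj
    simp only [Finset.mem_filter, Finset.mem_range, Finset.mem_Icc] at hj ⊢
    exact ⟨by omega, hj.2⟩
  · intro i _ j _ h
    simpa using h
  · intro i hi
    simp only [Finset.mem_filter, Finset.mem_Icc] at hi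
    refine ⟨(i - 1).toNat, ?_, by omega⟩
    have : (((i - 1).toNat : ℤ) + 1) = i := by omega
    simp only [Finset.mem_filter, Finset.mem_range, this]
    exact ⟨by omega, hi.2⟩

/-- Position `j` of the word of `w`, extended by `+∞`, is a descent. -/
noncomputable def descentAt {m : ℕ} (w : Equiv.Perm (Fin m)) (j : ℕ) : Bool :=
  decide (extendA (permWord w) j > extendA (permWord w) (j + 1))

theorem descentAt_zero {m : ℕ} (w : Equiv.Perm (Fin (m + 1))) : descentAt w 0 = true := by
  simp [descentAt, extendA]

theorem descentAt_last {m : ℕ} (w : Equiv.Perm (Fin m)) : descentAt w m = false := by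
  simp [descentAt, extendA]

theorem card_DesA {m : ℕ} (w : Equiv.Perm (Fin m)) :
    (DesA w).card = ((Finset.range m).filter fun j => descentAt w (j + 1)).card := by
  rw [DesA, card_filter_Icc_int]
  simp [descentAt]

theorem card_DDesA {m : ℕ} (w : Equiv.Perm (Fin m)) :
    (DDesA w).card =
      ((Finset.range m).filter fun j => descentAt w j ∧ descentAt w (j + 1)).card := by
  rw [DDesA, card_filter_Icc_int]
  simp [descentAt]

theorem wordWeight_permList {R : Type*} [CommRing R] (s : Bool → Bool → R) {n : ℕ}
    (w : Equiv.Perm (Fin (n + 1))) :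
    wordWeight s true (permList w) true =
      ∏ j ∈ Finset.range (n + 1), s (descentAt w j) (!descentAt w (j + 1)) := by
  have := wordWeight_eq_prod s (extendA (permWord w)) (permList w) (by simp [permList])
    (List.nodup_ofFn.2 fun i j h => w.injective (Fin.ext h)) 0 (fun j hj => by
      have hj : j < n + 1 := by simpa [permList] using hj
      rw [extendA, dif_pos (by push_cast; omega)]
      simp [permList, permWord, -List.ofFn_succ])
  have hlen : (permList w).length = n + 1 := by simp [permList]
  have e0 : decide (extendA (permWord w) 0 > extendA (permWord w) (0 + 1)) = true := by
    simpa [descentAt] using descentAt_zero w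
  have e1 : decide (extendA (permWord w) (0 + ((n + 1 : ℕ) : ℤ)) >
      extendA (permWord w) (0 + ((n + 1 : ℕ) : ℤ) + 1)) = false := by
    simpa [descentAt] using descentAt_last w
  rw [hlen, e0, e1] at this
  rw [Bool.not_false] at this
  rw [this]
  refine Finset.prod_congr rfl fun j _ => ?_
  simp [descentAt, add_assoc, one_add_one_eq_two]

theorem wordWeight_permList_des {n : ℕ} (w : Equiv.Perm (Fin (n + 1))) :
    wordWeight (letterWeight X X 1) true (permList w) true = (X : ℤ[X]) ^ (DesA w).card := by
  rw [wordWeight_permList, prod_letterWeight_eq_pow, card_DesA]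

theorem two_mul_card_DesA_le {n : ℕ} (w : Equiv.Perm (Fin (n + 1))) (h : (DDesA w).card = 0) :
    2 * (DesA w).card ≤ n ∧ wordWeight (letterWeight X 0 (1 + X)) true (permList w) true =
      (X : ℤ[X]) ^ (DesA w).card * (1 + X) ^ (n - 2 * (DesA w).card) := by
  rw [card_DDesA, Finset.card_eq_zero, Finset.filter_eq_empty_iff] at h
  obtain ⟨r, h1, h2⟩ := exists_prod_letterWeight_eq (X : ℤ[X]) 0 (1 + X) (descentAt w) (n + 1)
    (descentAt_zero w) fun j hj => h (Finset.mem_range.2 hj)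
  rw [descentAt_last, cond_false, ← card_DesA] at h1
  rw [← card_DesA] at h2
  refine ⟨by omega, ?_⟩
  rw [wordWeight_permList, h2]
  congr 2
  omega

theorem wordWeight_permList_eq_zero {n : ℕ} (w : Equiv.Perm (Fin (n + 1)))
    (h : (DDesA w).card ≠ 0) :
    wordWeight (letterWeight (X : ℤ[X]) 0 (1 + X)) true (permList w) true = 0 := by
  rw [card_DDesA, Finset.card_ne_zero] at h
  obtain ⟨j, hj⟩ := h
  obtain ⟨hj, h1, h2⟩ := Finset.mem_filter.1 hj
  rw [wordWeight_permList]
  exact Finset.prod_eq_zero hj (by simp [h1, h2, letterWeight])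

/-- The γ-expansion of the descent polynomial of separable permutations. -/
theorem descentPolyA_eq_sum (n : ℕ) :
    descentPolyA (n + 1) =
      ∑ k ∈ Finset.range (n / 2 + 1),
        C (gammaA (n + 1) k : ℤ) * X ^ k * (1 + X) ^ (n - 2 * k) := by
  -- Both weightings have `u + v = 1 + X`: the first gives `X` to every descent, the second vanishes
  -- as soon as there is a double descent.
  have h := sum_sepLists_eq (t := (X : ℤ[X])) (u := X) (v := 1) (u' := 0) (v' := 1 + X)
    (by ring) (n + 1)
  rw [← sum_sepA n fun l => wordWeight (letterWeight (X : ℤ[X]) X 1) true l true,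
    ← sum_sepA n fun l => wordWeight (letterWeight (X : ℤ[X]) 0 (1 + X)) true l true] at h
  simp only [wordWeight_permList_des] at h
  rw [descentPolyA, h, ← Finset.sum_filter_of_ne (p := fun w => (DDesA w).card = 0)
    fun w _ hw => by_contra fun h => hw (wordWeight_permList_eq_zero w h)]
  rw [← Finset.sum_fiberwise_of_maps_to (t := Finset.range (n / 2 + 1))
    (g := fun w => (DesA w).card)]
  · refine Finset.sum_congr rfl fun k _ => ?_
    rw [Finset.filter_filter, gammaA, Finset.sum_congr rfl (g := fun _ =>
      (X : ℤ[X]) ^ k * (1 + X) ^ (n - 2 * k)), Finset.sum_const]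
    · simp [mul_assoc]
    · intro w hw
      obtain ⟨-, h1, rfl⟩ := Finset.mem_filter.1 hw
      exact (two_mul_card_DesA_le w h1).2
  · intro w hw
    have := (two_mul_card_DesA_le w (Finset.mem_filter.1 hw).2).1
    simp only [Finset.mem_range]
    omega

/-- The identity has no descent. This makes the constant coefficient non-zero, and by symmetry the
degree exactly `n`. -/
theorem gammaA_zero_pos (n : ℕ) : 0 < gammaA (n + 1) 0 := by
  refine Finset.card_pos.2 ⟨1, ?_⟩
  have hD : DesA (1 : Equiv.Perm (Fin (n + 1))) = ∅ := by
    rw [← Finset.card_eq_zero, card_DesA, Finset.card_eq_zero, Finset.filter_eq_empty_iff]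
    intro j hj
    rw [Finset.mem_range] at hj
    simp only [descentAt, extendA, permWord, gt_iff_lt, decide_eq_true_eq, not_lt,
      Equiv.Perm.coe_one, id]
    split_ifs with h1 h2
    · simp only [WithTop.coe_le_coe]
      push_cast at *
      omega
    all_goals first | exact le_top | (exfalso; push_cast at *; omega)
  have hDD : DDesA (1 : Equiv.Perm (Fin (n + 1))) = ∅ := by
    rw [← Finset.subset_empty, ← hD]
    intro i hi
    simp only [DDesA, DesA, Finset.mem_filter] at hi ⊢
    exact ⟨hi.1, hi.2.2⟩
  refine Finset.mem_filter.2 ⟨Finset.mem_filter.2 ⟨Finset.mem_univ _, isSeparableA_iff.2 ?_⟩,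
    by simp [hDD], by simp [hD]⟩
  intro f hf
  have h1 := hf (show (0 : Fin 4) < 1 by decide)
  have h2 := hf (show (1 : Fin 4) < 2 by decide)
  have h3 := hf (show (2 : Fin 4) < 3 by decide)
  simp only [Equiv.Perm.coe_one, id]
  omega

/-! ### Signed patterns and standardization -/

/-- Negation reverses the order, so the values themselves are in the order of 2413. -/
theorem containsPattern_neg_3142_iff {n : ℕ} {a : Fin n → ℤ} :
    ContainsPattern a ![-3, -1, -4, -2] ↔ ∃ f : Fin 4 → Fin n, StrictMono f ∧
      (∀ i, a (f i) < 0) ∧ a (f 2) < a (f 0) ∧ a (f 0) < a (f 3) ∧ a (f 3) < a (f 1) := by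
  constructor
  · rintro ⟨f, h1, h2, h3⟩
    have hp : ∀ i, a (f i) < 0 := fun i => by
      have := h2 i
      fin_cases i <;> simp at this ⊢ <;> omega
    have p1 := h3 0 2
    have p2 := h3 3 0
    have p3 := h3 1 3
    simp only [abs_of_neg (hp _), neg_lt_neg_iff] at p1 p2 p3
    refine ⟨f, fun i j => h1 i j, hp, p1.2 ?_, p2.2 ?_, p3.2 ?_⟩ <;> simp
  · rintro ⟨f, h1, hp, p1, p2, p3⟩
    refine ⟨f, fun i j h => h1 h, fun i => ?_, fun i j => ?_⟩
    · have := hp i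
      fin_cases i <;> simp at this ⊢ <;> omega
    · simp only [abs_of_neg (hp _)]
      fin_cases i <;> fin_cases j <;> simp <;> omega

theorem containsPattern_neg_2413_iff {n : ℕ} {a : Fin n → ℤ} :
    ContainsPattern a ![-2, -4, -1, -3] ↔ ∃ f : Fin 4 → Fin n, StrictMono f ∧
      (∀ i, a (f i) < 0) ∧ a (f 1) < a (f 3) ∧ a (f 3) < a (f 0) ∧ a (f 0) < a (f 2) := by
  constructor
  · rintro ⟨f, h1, h2, h3⟩
    have hp : ∀ i, a (f i) < 0 := fun i => by
      have := h2 i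
      fin_cases i <;> simp at this ⊢ <;> omega
    have p1 := h3 3 1
    have p2 := h3 0 3
    have p3 := h3 2 0
    simp only [abs_of_neg (hp _), neg_lt_neg_iff] at p1 p2 p3
    refine ⟨f, fun i j => h1 i j, hp, p1.2 ?_, p2.2 ?_, p3.2 ?_⟩ <;> simp
  · rintro ⟨f, h1, hp, p1, p2, p3⟩
    refine ⟨f, fun i j h => h1 h, fun i => ?_, fun i j => ?_⟩
    · have := hp i
      fin_cases i <;> simp at this ⊢ <;> omega
    · simp only [abs_of_neg (hp _)]
      fin_cases i <;> fin_cases j <;> simp <;> omega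

theorem containsPattern_neg_two_one_iff {n : ℕ} {a : Fin n → ℤ} :
    ContainsPattern a ![-2, 1] ↔ ∃ i j, i < j ∧ a i < 0 ∧ 0 ≤ a j ∧ a j < -a i := by
  constructor
  · rintro ⟨f, h1, h2, h3⟩
    have p0 : a (f 0) < 0 := (h2 0).2 (by simp)
    have p1 : 0 ≤ a (f 1) := not_lt.1 fun h => by simpa using (h2 1).1 h
    have p2 := (h3 1 0).2 (by simp)
    rw [abs_of_neg p0, abs_of_nonneg p1] at p2
    exact ⟨f 0, f 1, h1 _ _ (by simp), p0, p1, p2⟩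
  · rintro ⟨i, j, hij, hi, hj, h⟩
    refine ⟨![i, j], ?_, ?_, ?_⟩
    · simp [Fin.forall_fin_two, hij]
    · simp [Fin.forall_fin_two, hi, hj]
    · simp [Fin.forall_fin_two, abs_of_neg hi, abs_of_nonneg hj]
      omega

theorem containsPattern_two_neg_one_iff {n : ℕ} {a : Fin n → ℤ} :
    ContainsPattern a ![2, -1] ↔ ∃ i j, i < j ∧ 0 ≤ a i ∧ a j < 0 ∧ -a j < a i := by
  constructor
  · rintro ⟨f, h1, h2, h3⟩
    have p0 : 0 ≤ a (f 0) := not_lt.1 fun h => by simpa using (h2 0).1 h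
    have p1 : a (f 1) < 0 := (h2 1).2 (by simp)
    have p2 := (h3 1 0).2 (by simp)
    rw [abs_of_neg p1, abs_of_nonneg p0] at p2
    exact ⟨f 0, f 1, h1 _ _ (by simp), p0, p1, p2⟩
  · rintro ⟨i, j, hij, hi, hj, h⟩
    refine ⟨![i, j], ?_, ?_, ?_⟩
    · simp [Fin.forall_fin_two, hij]
    · simp [Fin.forall_fin_two, hi, hj]
    · simp [Fin.forall_fin_two, abs_of_neg hj, abs_of_nonneg hi]
      omega

section Standardization

variable {m : ℕ}

/-- The permutation with the same relative order as a word with distinct letters. -/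
def standardize (a : Fin m → ℤ) : Equiv.Perm (Fin m) := (Tuple.sort a)⁻¹

theorem standardize_lt_iff {a : Fin m → ℤ} (ha : Function.Injective a) (i j : Fin m) :
    standardize a i < standardize a j ↔ a i < a j := by
  have hs : StrictMono (a ∘ Tuple.sort a) :=
    (Tuple.monotone_sort a).strictMono_of_injective (ha.comp (Tuple.sort a).injective)
  rw [← hs.lt_iff_lt]
  simp [standardize]

theorem perm_eq_of_lt_iff_lt {v v' : Equiv.Perm (Fin m)} (h : ∀ i j, v i < v j ↔ v' i < v' j) :
    v = v' := by
  have hm : StrictMono (v.symm.trans v') := fun i j hij => by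
    rw [Equiv.trans_apply, Equiv.trans_apply, ← h]
    simpa using hij
  have : hm.orderIsoOfSurjective _ (v.symm.trans v').surjective = OrderIso.refl _ :=
    Subsingleton.elim _ _
  ext i
  have := DFunLike.congr_fun this (v i)
  simpa using (congrArg Fin.val this).symm

/-- Both words are permutations of `1, …, m`, and a permutation is determined by its relative order.
-/
theorem eq_of_lt_iff_lt {a b : Fin m → ℤ} (ha : Function.Injective a) (hb : Function.Injective b)
    (ha1 : ∀ i, 1 ≤ a i ∧ a i ≤ m) (hb1 : ∀ i, 1 ≤ b i ∧ b i ≤ m)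
    (h : ∀ i j, a i < a j ↔ b i < b j) : a = b := by
  have key : ∀ c : Fin m → ℤ, Function.Injective c → (∀ i, 1 ≤ c i ∧ c i ≤ m) →
      ∃ v : Equiv.Perm (Fin m), ∀ i, c i = (v i : ℕ) + 1 := by
    intro c hc hc1
    let g : Fin m → Fin m := fun i => ⟨(c i - 1).toNat, by have := hc1 i; omega⟩
    have hg : Function.Injective g := fun i j hij => hc (by
      have := congrArg Fin.val hij
      simp only [g] at this
      have := hc1 i
      have := hc1 j
      omega)
    refine ⟨Equiv.ofBijective g (Finite.injective_iff_bijective.1 hg), fun i => ?_⟩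
    have := hc1 i
    simp only [Equiv.ofBijective_apply, g]
    omega
  obtain ⟨v, hv⟩ := key a ha ha1
  obtain ⟨v', hv'⟩ := key b hb hb1
  have : v = v' := perm_eq_of_lt_iff_lt fun i j => by
    have := h i j
    rw [hv, hv, hv', hv'] at this
    simpa using this
  subst this
  funext i
  rw [hv, hv']

theorem SepFun.congr {α β : Type*} [LT α] [LT β] {a : Fin m → α} {b : Fin m → β}
    (h : ∀ i j, a i < a j ↔ b i < b j) (ha : SepFun a) : SepFun b := by
  intro f hf
  simp only [← h]
  exact ha f hf

theorem extendA_lt_iff {a b : Fin m → ℤ} (h : ∀ i j, a i < a j ↔ b i < b j) (i j : ℤ) :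
    extendA a i > extendA a j ↔ extendA b i > extendA b j := by
  unfold extendA
  split_ifs <;> simp [h]

end Standardization

/-! ### The bijection between signed and unsigned separable permutations -/

/-- Four integers of mixed signs such that letters of opposite signs increase in absolute value have
neither the order of `3142` nor that of `2413`. -/
theorem not_pattern_of_mixed_signs {x y z t : ℤ} (hy : y ≠ 0) (hz : z ≠ 0) (ht : t ≠ 0)
    (h1 : (x < 0 → 0 < y → -x < y) ∧ (0 < x → y < 0 → x < -y))
    (h2 : (y < 0 → 0 < z → -y < z) ∧ (0 < y → z < 0 → y < -z))
    (h3 : (y < 0 → 0 < t → -y < t) ∧ (0 < y → t < 0 → y < -t))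
    (h4 : (z < 0 → 0 < t → -z < t) ∧ (0 < z → t < 0 → z < -t))
    (hpos : ¬ (0 < x ∧ 0 < y ∧ 0 < z ∧ 0 < t)) (hneg : ¬ (x < 0 ∧ y < 0 ∧ z < 0 ∧ t < 0)) :
    ¬ (y < t ∧ t < x ∧ x < z) ∧ ¬ (z < x ∧ x < t ∧ t < y) := by
  -- The sign of `x` is not split, since `x` may be the prepended 0.
  rcases lt_or_gt_of_ne hy with hy | hy <;> rcases lt_or_gt_of_ne hz with hz | hz <;>
    rcases lt_or_gt_of_ne ht with ht | ht <;>
    simp only [hy, hz, ht, hy.not_gt, hz.not_gt, ht.not_gt, forall_const, IsEmpty.forall_iff,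
      and_true, true_and, and_false] at h1 h2 h3 h4 hpos hneg <;> omega

/-- The order by absolute values of the signed permutation to be recovered from a permutation whose
first letter is `o`: `x` is the letter at position `i`. -/
def AbsLT (o x i y j : ℕ) : Prop :=
  (x < o ∧ y < o ∧ y < x) ∨ (o < x ∧ o < y ∧ x < y) ∨ (x < o ∧ o < y ∧ i < j) ∨
    (o < x ∧ y < o ∧ i < j)

theorem AbsLT.irrefl (o x i : ℕ) : ¬ AbsLT o x i x i := by
  unfold AbsLT
  omega

theorem AbsLT.total {o x i y j : ℕ} (hx : x ≠ o) (hy : y ≠ o) (hxy : x ≠ y) (hij : i ≠ j) :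
    AbsLT o x i y j ∨ AbsLT o y j x i := by
  rcases lt_or_gt_of_ne hx with hx | hx <;> rcases lt_or_gt_of_ne hy with hy | hy <;>
    simp only [AbsLT, hx, hy, hx.not_gt, hy.not_gt, true_and, false_and, false_or, or_false] <;>
    omega

/-- The only threat is a cycle among two letters on one side of `o` and one on the other. Its
positions are increasing up to rotation, and after the leading `o` the three letters then form a
3142 or a 2413. `H₁`, `H₂`, `H₃` exclude this for the three rotations. -/
theorem AbsLT.trans {o x y z i j k : ℕ}
    (H₁ : i < j → j < k → ¬ (x < z ∧ z < o ∧ o < y) ∧ ¬ (y < o ∧ o < z ∧ z < x))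
    (H₂ : j < k → k < i → ¬ (y < x ∧ x < o ∧ o < z) ∧ ¬ (z < o ∧ o < x ∧ x < y))
    (H₃ : k < i → i < j → ¬ (z < y ∧ y < o ∧ o < x) ∧ ¬ (x < o ∧ o < y ∧ y < z))
    (hxz : x = z → i = k) (hik : i = k → x = z) (h1 : AbsLT o x i y j) (h2 : AbsLT o y j z k) :
    AbsLT o x i z k := by
  unfold AbsLT at *
  rcases h1 with h1 | h1 | h1 | h1
  · rcases h2 with h2 | h2 | h2 | h2
    · clear H₁ H₂ H₃ hxz hik; omega
    · clear H₁ H₂ H₃ hxz hik; omega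
    · clear H₁ H₃ hxz; omega
    · clear H₁ H₂ H₃ hxz hik; omega
  · rcases h2 with h2 | h2 | h2 | h2
    · clear H₁ H₂ H₃ hxz hik; omega
    · clear H₁ H₂ H₃ hxz hik; omega
    · clear H₁ H₂ H₃ hxz hik; omega
    · clear H₁ H₃ hxz; omega
  · rcases h2 with h2 | h2 | h2 | h2
    · clear H₁ H₂ H₃ hxz hik; omega
    · clear H₁ H₂ hxz; omega
    · clear H₁ H₂ H₃ hxz hik; omega
    · clear H₂ H₃ hik; omega
  · rcases h2 with h2 | h2 | h2 | h2
    · clear H₁ H₂ hxz; omega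
    · clear H₁ H₂ H₃ hxz hik; omega
    · clear H₂ H₃ hik; omega
    · clear H₁ H₂ H₃ hxz hik; omega

namespace SignedPerm

variable {n : ℕ}

theorem word_bounds (w : SignedPerm n) (i : Fin n) :
    w.word i ≠ 0 ∧ 1 ≤ |w.word i| ∧ |w.word i| ≤ n := by
  have := (w.1 ⟨(i : ℤ) + 1, by
    have h := i.2
    simp only [Finset.mem_erase, Finset.mem_Icc]
    omega⟩).2
  simp only [Finset.mem_erase, Finset.mem_Icc] at this
  change w.word i ≠ 0 ∧ -(n : ℤ) ≤ w.word i ∧ w.word i ≤ n at this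
  refine ⟨this.1, Int.one_le_abs this.1, abs_le.2 this.2⟩

theorem abs_word_injective (w : SignedPerm n) : Function.Injective fun i => |w.word i| := by
  intro i j h
  rcases abs_eq_abs.1 h with h | h
  · have := w.1.injective (Subtype.ext h)
    have := congrArg Subtype.val this
    simp only at this
    exact Fin.ext (by omega)
  · unfold word at h
    have h' := w.2 ⟨(j : ℤ) + 1, by
      have h := j.2
      simp only [Finset.mem_erase, Finset.mem_Icc]
      omega⟩
    have := w.1.injective ((Subtype.ext h).trans h'.symm)
    have := congrArg Subtype.val this
    change ((i : ℤ) + 1) = -((j : ℤ) + 1) at this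
    omega

theorem word_injective (w : SignedPerm n) : Function.Injective w.word :=
  fun i j h => w.abs_word_injective (by simp [h])

theorem ext_word {w w' : SignedPerm n} (h : w.word = w'.word) : w = w' := by
  have pos : ∀ x : SignedSet n, 0 < x.1 → w.1 x = w'.1 x := by
    rintro ⟨x, hx⟩ h0
    have hx' := hx
    simp only [Finset.mem_erase, Finset.mem_Icc] at hx'
    obtain ⟨i, rfl⟩ : ∃ i : Fin n, x = (i : ℤ) + 1 :=
      ⟨⟨(x - 1).toNat, by omega⟩, by simp only at h0 ⊢; omega⟩
    exact Subtype.ext (congrFun h i)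
  refine Subtype.ext (Equiv.ext fun x => ?_)
  rcases lt_or_ge 0 x.1 with h0 | h0
  · exact pos x h0
  · have hx := x.2
    simp only [Finset.mem_erase, Finset.mem_Icc] at hx
    have hneg : 0 < (-x).1 := by
      change 0 < -x.1
      omega
    have := pos (-x) hneg
    rw [w.2, w'.2] at this
    have := congrArg Subtype.val this
    exact Subtype.ext (neg_injective this)

theorem exists_word_eq {a : Fin n → ℤ} (h1 : ∀ i, 1 ≤ |a i| ∧ |a i| ≤ n)
    (h2 : Function.Injective fun i => |a i|) : ∃ w : SignedPerm n, w.word = a := by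
  have hmem : ∀ x : SignedSet n, x.1 ≠ 0 ∧ -(n : ℤ) ≤ x.1 ∧ x.1 ≤ n := fun x => by
    have := x.2
    simpa only [Finset.mem_erase, Finset.mem_Icc] using this
  have idx : ∀ x : SignedSet n, x.1.natAbs - 1 < n := fun x => by
    have := hmem x
    omega
  let g : SignedSet n → SignedSet n := fun x =>
    ⟨x.1.sign * a ⟨x.1.natAbs - 1, idx x⟩, by
      have hx := hmem x
      have ha := h1 ⟨x.1.natAbs - 1, idx x⟩
      rw [Finset.mem_erase, Finset.mem_Icc, ← abs_le, abs_mul, Int.abs_sign_of_ne_zero hx.1,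
        one_mul]
      refine ⟨mul_ne_zero (mt Int.sign_eq_zero_iff_zero.1 hx.1) fun h => ?_, ha.2⟩
      rw [h] at ha
      simp at ha⟩
  have hg : Function.Injective g := by
    intro x y h
    have h := congrArg Subtype.val h
    simp only [g] at h
    have hx := hmem x
    have hy := hmem y
    have e := congrArg abs h
    rw [abs_mul, abs_mul, Int.abs_sign_of_ne_zero hx.1, Int.abs_sign_of_ne_zero hy.1, one_mul,
      one_mul] at e
    have e' := h2 e
    have e'' := congrArg Fin.val e'
    simp only at e''
    rw [e'] at h
    have hne : a ⟨y.1.natAbs - 1, idx y⟩ ≠ 0 := fun h0 => by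
      have := (h1 ⟨y.1.natAbs - 1, idx y⟩).1
      rw [h0] at this
      simp at this
    have hs := mul_right_cancel₀ hne h
    apply Subtype.ext
    rw [← Int.sign_mul_natAbs x.1, ← Int.sign_mul_natAbs y.1, hs]
    congr 2
    omega
  refine ⟨⟨Equiv.ofBijective g (Finite.injective_iff_bijective.1 hg), fun x => ?_⟩, ?_⟩
  · apply Subtype.ext
    change (-x.1).sign * a ⟨(-x.1).natAbs - 1, _⟩ = -(x.1.sign * a ⟨x.1.natAbs - 1, _⟩)
    simp only [Int.sign_neg, Int.natAbs_neg, neg_mul]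
  · funext i
    change ((i : ℤ) + 1).sign * a ⟨((i : ℤ) + 1).natAbs - 1, _⟩ = a i
    rw [Int.sign_eq_one_of_pos (by omega), one_mul]
    congr 1

/-- The word `0 w₁ ⋯ w_n`. -/
def zeroWord (w : SignedPerm n) : Fin (n + 1) → ℤ := Fin.cons 0 w.word

theorem zeroWord_zero (w : SignedPerm n) : w.zeroWord 0 = 0 := rfl

theorem zeroWord_succ (w : SignedPerm n) (i : Fin n) : w.zeroWord i.succ = w.word i := rfl

theorem zeroWord_injective (w : SignedPerm n) : Function.Injective w.zeroWord := by
  refine Fin.cons_injective_iff.2 ⟨?_, w.word_injective⟩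
  rintro ⟨i, hi⟩
  exact (w.word_bounds i).1 hi

/-- The prepended 0 is the type-B letter `w₀`, and `w_{-1} = +∞` becomes the left end of the type-A
convention. -/
theorem extendB_word (w : SignedPerm n) (i : ℤ) :
    extendB w.word i = extendA w.zeroWord (i + 1) := by
  rcases lt_trichotomy i 0 with h | rfl | h
  · simp [extendB, extendA, h.ne, show ¬ 1 ≤ i by omega, show ¬ 0 ≤ i by omega]
  · simp [extendB, extendA, zeroWord]
  · rw [extendB, if_neg h.ne']
    unfold extendA
    by_cases hi : i ≤ n
    · rw [dif_pos (by omega), dif_pos (by push_cast; omega)]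
      have : (⟨(i + 1 - 1).toNat, by omega⟩ : Fin (n + 1)) =
          Fin.succ (⟨(i - 1).toNat, by omega⟩ : Fin n) := by
        ext
        simp only [Fin.val_succ]
        omega
      rw [this, zeroWord_succ]
    · rw [dif_neg (by omega), dif_neg (by push_cast; omega)]

/-- Letters of opposite signs increase in absolute value. -/
def OppositeIncreasing (w : SignedPerm n) : Prop :=
  ∀ i j, i < j → (w.word i < 0 → 0 < w.word j → -w.word i < w.word j) ∧
    (0 < w.word i → w.word j < 0 → w.word i < -w.word j)

/-- The two patterns of length 2 give the first condition. Occurrences of 3142 or 2413 with letters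
of one sign are the four long signed patterns; those with mixed signs, or with the prepended 0, are
ruled out by `not_pattern_of_mixed_signs`. -/
theorem isSeparableB_iff (w : SignedPerm n) :
    IsSeparableB w ↔ w.OppositeIncreasing ∧ SepFun w.zeroWord := by
  rw [IsSeparableB, containsPattern_neg_two_one_iff, containsPattern_two_neg_one_iff,
    containsPattern_3142_iff, containsPattern_2413_iff, containsPattern_neg_3142_iff,
    containsPattern_neg_2413_iff]
  constructor
  · rintro ⟨h1, h2, h3, h4, h5, h6⟩
    have hopp : w.OppositeIncreasing := by
      intro i j hij
      have hne : |w.word i| ≠ |w.word j| := fun h => hij.ne (w.abs_word_injective h)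
      constructor <;> intro hi hj <;> by_contra hlt
      · rw [abs_of_neg hi, abs_of_pos hj] at hne
        exact h1 ⟨i, j, hij, hi, hj.le, by omega⟩
      · rw [abs_of_neg hj, abs_of_pos hi] at hne
        exact h2 ⟨i, j, hij, hi.le, hj, by omega⟩
    refine ⟨hopp, fun f hf => ?_⟩
    have hopp' : ∀ i j, i < j →
        (w.zeroWord (f i) < 0 → 0 < w.zeroWord (f j) →
          -w.zeroWord (f i) < w.zeroWord (f j)) ∧
        (0 < w.zeroWord (f i) → w.zeroWord (f j) < 0 →
          w.zeroWord (f i) < -w.zeroWord (f j)) := by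
      intro i j hij
      have := hf hij
      rcases Fin.eq_zero_or_eq_succ (f i) with hi | ⟨i', hi⟩
      · simp [hi, zeroWord_zero]
      · rcases Fin.eq_zero_or_eq_succ (f j) with hj | ⟨j', hj⟩
        · simp [hj, zeroWord_zero]
        · rw [hi, hj] at this ⊢
          exact hopp _ _ (Fin.succ_lt_succ_iff.1 this)
    -- Only the first letter of an occurrence can be the prepended 0.
    have hne : ∀ i, 0 < i → w.zeroWord (f i) ≠ 0 := by
      intro i hi h
      have := w.zeroWord_injective (h.trans w.zeroWord_zero.symm)
      have hlt := hf hi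
      rw [this] at hlt
      exact absurd hlt (Fin.not_lt_zero _)
    have hg : (∀ i, w.zeroWord (f i) ≠ 0) → ∃ g : Fin 4 → Fin n, StrictMono g ∧
        ∀ i, w.word (g i) = w.zeroWord (f i) := by
      intro h
      have hf0 : ∀ i, f i ≠ 0 := fun i hi => h i (by rw [hi, zeroWord_zero])
      refine ⟨fun i => (f i).pred (hf0 i), fun i j hij => ?_, fun i => ?_⟩
      · simpa using hf hij
      · rw [← zeroWord_succ, Fin.succ_pred]
    have n1 := hne 1 (by decide)
    have n2 := hne 2 (by decide)
    have n3 := hne 3 (by decide)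
    have o01 := hopp' 0 1 (by decide)
    have o12 := hopp' 1 2 (by decide)
    have o13 := hopp' 1 3 (by decide)
    have o23 := hopp' 2 3 (by decide)
    by_cases hpos : ∀ i, 0 < w.zeroWord (f i)
    · obtain ⟨g, hgm, hgw⟩ := hg fun i => (hpos i).ne'
      simp only [← hgw] at hpos ⊢
      exact ⟨fun h => h3 ⟨g, hgm, fun i => (hpos i).le, h⟩,
        fun h => h4 ⟨g, hgm, fun i => (hpos i).le, h⟩⟩
    by_cases hneg : ∀ i, w.zeroWord (f i) < 0
    · obtain ⟨g, hgm, hgw⟩ := hg fun i => (hneg i).ne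
      simp only [← hgw] at hneg ⊢
      exact ⟨fun h => h6 ⟨g, hgm, hneg, h⟩, fun h => h5 ⟨g, hgm, hneg, h⟩⟩
    refine not_pattern_of_mixed_signs n1 n2 n3 o01 o12 o13 o23 (fun h => hpos ?_)
      fun h => hneg ?_
    all_goals
      intro i
      fin_cases i
      exacts [h.1, h.2.1, h.2.2.1, h.2.2.2]
  · rintro ⟨hopp, hs⟩
    refine ⟨?_, ?_, ?_, ?_, ?_, ?_⟩
    · rintro ⟨i, j, hij, hi, hj, h⟩
      have := (w.word_bounds j).1
      have := (hopp i j hij).1 hi (by omega)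
      omega
    · rintro ⟨i, j, hij, hi, hj, h⟩
      have := (w.word_bounds i).1
      have := (hopp i j hij).2 (by omega) hj
      omega
    · rintro ⟨f, hf, -, h⟩
      exact (hs _ ((Fin.strictMono_succ).comp hf)).1 h
    · rintro ⟨f, hf, -, h⟩
      exact (hs _ ((Fin.strictMono_succ).comp hf)).2 h
    · rintro ⟨f, hf, -, h⟩
      exact (hs _ ((Fin.strictMono_succ).comp hf)).2 h
    · rintro ⟨f, hf, -, h⟩
      exact (hs _ ((Fin.strictMono_succ).comp hf)).1 h

/-- The permutation with the same relative order as the word `0 w₁ ⋯ w_n`. -/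
def toPerm (w : SignedPerm n) : Equiv.Perm (Fin (n + 1)) := standardize w.zeroWord

theorem toPerm_lt_iff (w : SignedPerm n) (i j : Fin (n + 1)) :
    w.toPerm i < w.toPerm j ↔ w.zeroWord i < w.zeroWord j :=
  standardize_lt_iff w.zeroWord_injective i j

theorem extendB_gt_iff (w : SignedPerm n) (i j : ℤ) :
    extendB w.word i > extendB w.word j ↔
      extendA (permWord w.toPerm) (i + 1) > extendA (permWord w.toPerm) (j + 1) := by
  rw [extendB_word, extendB_word]
  refine extendA_lt_iff (fun i j => ?_) _ _
  rw [← toPerm_lt_iff]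
  simp [permWord]

theorem card_filter_Icc_shift (n : ℕ) {p q : ℤ → Prop} [DecidablePred p] [DecidablePred q]
    (h : ∀ i, p i ↔ q (i + 1)) :
    ((Finset.Icc 0 (n : ℤ)).filter p).card =
      ((Finset.Icc 1 ((n + 1 : ℕ) : ℤ)).filter q).card := by
  refine Finset.card_nbij' (· + 1) (· - 1) ?_ ?_ ?_ ?_
  · intro i hi
    simp only [Finset.mem_coe, Finset.mem_filter, Finset.mem_Icc, h] at hi ⊢
    exact ⟨by push_cast; omega, hi.2⟩
  · intro i hi
    simp only [Finset.mem_coe, Finset.mem_filter, Finset.mem_Icc, h, sub_add_cancel] at hi ⊢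
    push_cast at hi
    exact ⟨by omega, hi.2⟩
  · intro i _
    simp
  · intro i _
    simp

theorem card_DesB (w : SignedPerm n) : (DesB w).card = (DesA w.toPerm).card :=
  card_filter_Icc_shift n fun i => w.extendB_gt_iff i (i + 1)

theorem card_DDesB (w : SignedPerm n) : (DDesB w).card = (DDesA w.toPerm).card :=
  card_filter_Icc_shift n fun i => by
    rw [w.extendB_gt_iff i (i + 1), w.extendB_gt_iff (i - 1) i]
    simp

/-- The order relative to the prepended 0 gives the signs. Absolute values are then compared by
value for equal signs and by position for opposite signs, so they are determined too. -/
theorem toPerm_injOn :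
    Set.InjOn (toPerm (n := n)) {w | w.OppositeIncreasing} := by
  intro w hw w' hw' h
  have hlt : ∀ i j, w.zeroWord i < w.zeroWord j ↔ w'.zeroWord i < w'.zeroWord j := fun i j => by
    rw [← toPerm_lt_iff, h, toPerm_lt_iff]
  have h1 : ∀ i j, w.word i < w.word j ↔ w'.word i < w'.word j := fun i j => hlt i.succ j.succ
  have h2 : ∀ i, w.word i < 0 ↔ w'.word i < 0 := fun i => hlt i.succ 0
  have key : ∀ u : SignedPerm n, u.OppositeIncreasing → ∀ i j, |u.word i| < |u.word j| ↔
      (u.word i < 0 ∧ u.word j < 0 ∧ u.word j < u.word i) ∨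
      (¬ u.word i < 0 ∧ ¬ u.word j < 0 ∧ u.word i < u.word j) ∨
      (¬ (u.word i < 0 ↔ u.word j < 0) ∧ i < j) := by
    intro u hu i j
    have hi := (u.word_bounds i).1
    have hj := (u.word_bounds j).1
    rcases lt_trichotomy i j with hij | rfl | hij
    · have o := hu i j hij
      have hji := hij.not_gt
      rcases lt_or_gt_of_ne hi with hi | hi <;> rcases lt_or_gt_of_ne hj with hj | hj <;>
        simp only [abs_of_neg, abs_of_pos, hi, hj, hi.not_gt, hj.not_gt, hij] at o ⊢ <;>
        simp at o ⊢ <;> omega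
    · simp
    · have o := hu j i hij
      have hji := hij.not_gt
      rcases lt_or_gt_of_ne hi with hi | hi <;> rcases lt_or_gt_of_ne hj with hj | hj <;>
        simp only [abs_of_neg, abs_of_pos, hi, hj, hi.not_gt, hj.not_gt, hji] at o ⊢ <;>
        simp at o ⊢ <;> omega
  have habs : (fun i => |w.word i|) = fun i => |w'.word i| :=
    eq_of_lt_iff_lt w.abs_word_injective w'.abs_word_injective (fun i => (w.word_bounds i).2)
      (fun i => (w'.word_bounds i).2) fun i j => by
        rw [key w hw, key w' hw', h1, h1, h2, h2]
  refine ext_word (funext fun i => ?_)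
  have e := congrFun habs i
  have := h2 i
  rcases abs_eq_abs.1 e with e | e
  · exact e
  · have := (w.word_bounds i).1
    omega

/-- A letter of `v` becomes negative if it is below `v 0`, and its absolute value is its rank for
`AbsLT`, which separability makes a strict total order. -/
theorem exists_toPerm_eq {v : Equiv.Perm (Fin (n + 1))} (hv : SepFun v) :
    ∃ w : SignedPerm n, w.OppositeIncreasing ∧ SepFun w.zeroWord ∧ w.toPerm = v := by
  classical
  obtain ⟨o, ho⟩ : ∃ o : ℕ, o = v 0 := ⟨_, rfl⟩
  obtain ⟨V, hV⟩ : ∃ V : Fin n → ℕ, ∀ i, V i = v i.succ := ⟨fun i => v i.succ, fun _ => rfl⟩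
  have hVo : ∀ i, V i ≠ o := fun i h => by
    rw [hV, ho] at h
    exact Fin.succ_ne_zero i (v.injective (Fin.ext h))
  have hVi : ∀ i j, V i = V j → i = j := fun i j h => by
    rw [hV, hV] at h
    exact Fin.succ_injective _ (v.injective (Fin.ext h))
  -- These are the occurrences of 3142 and 2413 that start at the first letter of `v`.
  have H : ∀ p q r : Fin n, p < q → q < r →
      ¬ (V p < V r ∧ V r < o ∧ o < V q) ∧ ¬ (V q < o ∧ o < V r ∧ V r < V p) := by
    intro p q r hpq hqr
    have := hv ![0, p.succ, q.succ, r.succ] (by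
      rw [Fin.strictMono_iff_lt_succ]
      intro i
      fin_cases i
      exacts [Fin.succ_pos _, Fin.succ_lt_succ_iff.2 hpq, Fin.succ_lt_succ_iff.2 hqr])
    rw [hV, hV, hV, ho]
    exact this
  let lt' : Fin n → Fin n → Prop := fun i j => AbsLT o (V i) i (V j) j
  have htrans : ∀ i j k, lt' i j → lt' j k → lt' i k := by
    intro i j k
    exact AbsLT.trans (H i j k) (H j k i) (H k i j) (fun h => by rw [hVi _ _ h])
      (fun h => by rw [Fin.ext h])
  have hirr : ∀ i, ¬ lt' i i := fun i => AbsLT.irrefl _ _ _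
  have htot : ∀ i j, i ≠ j → lt' i j ∨ lt' j i :=
    fun i j hij => AbsLT.total (hVo i) (hVo j) (fun h => hij (hVi i j h))
      fun h => hij (Fin.ext h)
  -- The rank counted from 0, hence the absolute value `c i + 1` below.
  let c : Fin n → ℕ := fun i => (Finset.univ.filter fun j => lt' j i).card
  have hc1 : ∀ i j, lt' i j → c i < c j := by
    intro i j hij
    refine Finset.card_lt_card ⟨fun k hk => ?_, fun hsub => ?_⟩
    · simp only [Finset.mem_filter, Finset.mem_univ, true_and] at hk ⊢
      exact htrans _ _ _ hk hij
    · have := hsub (Finset.mem_filter.2 ⟨Finset.mem_univ i, hij⟩)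
      exact hirr i (Finset.mem_filter.1 this).2
  have hcn : ∀ i, c i < n := by
    intro i
    have : c i < (Finset.univ : Finset (Fin n)).card :=
      Finset.card_lt_card ⟨Finset.filter_subset _ _, fun hsub =>
        hirr i (Finset.mem_filter.1 (hsub (Finset.mem_univ i))).2⟩
    simpa using this
  have hci : Function.Injective c := by
    intro i j h
    by_contra hij
    rcases htot i j hij with h' | h' <;> have := hc1 _ _ h' <;> omega
  have hciff : ∀ i j, c i < c j ↔ lt' i j := by
    refine fun i j => ⟨fun h => ?_, hc1 i j⟩
    rcases htot i j fun hij => by simp [hij] at h with h' | h'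
    · exact h'
    · have := hc1 _ _ h'
      omega
  have habs : ∀ i, |if V i < o then -((c i : ℤ) + 1) else (c i : ℤ) + 1| = (c i : ℤ) + 1 := by
    intro i
    split_ifs
    · rw [abs_neg, abs_of_pos (by positivity)]
    · rw [abs_of_pos (by positivity)]
  obtain ⟨w, hw⟩ := exists_word_eq
    (a := fun i => if V i < o then -((c i : ℤ) + 1) else (c i : ℤ) + 1)
    (fun i => by rw [habs]; have := hcn i; omega)
    (fun i j h => by simp only [habs] at h; exact hci (by omega))
  have hwlt : ∀ i, V i < o → w.word i = -((c i : ℤ) + 1) := fun i hi => by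
    rw [hw]; exact if_pos hi
  have hwgt : ∀ i, ¬ V i < o → w.word i = (c i : ℤ) + 1 := fun i hi => by
    rw [hw]; exact if_neg hi
  have hneg : ∀ i, w.word i < 0 ↔ V i < o := by
    intro i
    by_cases hi : V i < o
    · have := hwlt i hi
      omega
    · have := hwgt i hi
      omega
  have hposi : ∀ i, 0 < w.word i ↔ o < V i := by
    intro i
    have := hneg i
    have := hVo i
    have := (w.word_bounds i).1
    omega
  have hword : ∀ i j, w.word i < w.word j ↔ V i < V j := by
    intro i j
    by_cases hij : i = j
    · subst hij
      simp
    · rcases lt_or_gt_of_ne (hVo i) with hi | hi <;> rcases lt_or_gt_of_ne (hVo j) with hj | hj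
      · rw [hwlt i hi, hwlt j hj, neg_lt_neg_iff, add_lt_add_iff_right, Nat.cast_lt, hciff]
        simp [lt', AbsLT, hi, hj, hi.not_gt, hj.not_gt]
      · rw [hwlt i hi, hwgt j hj.not_gt]
        omega
      · rw [hwgt i hi.not_gt, hwlt j hj]
        omega
      · rw [hwgt i hi.not_gt, hwgt j hj.not_gt, add_lt_add_iff_right, Nat.cast_lt, hciff]
        simp [lt', AbsLT, hi, hj, hi.not_gt, hj.not_gt]
  have hzero : ∀ i j, w.zeroWord i < w.zeroWord j ↔ v i < v j := by
    intro i j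
    rw [Fin.lt_def]
    rcases Fin.eq_zero_or_eq_succ i with rfl | ⟨i, rfl⟩ <;>
      rcases Fin.eq_zero_or_eq_succ j with rfl | ⟨j, rfl⟩
    · simp
    · rw [zeroWord_zero, zeroWord_succ, ← ho, ← hV, hposi]
    · rw [zeroWord_zero, zeroWord_succ, ← ho, ← hV, hneg]
    · rw [zeroWord_succ, zeroWord_succ, ← hV, ← hV, hword]
  refine ⟨w, fun i j hij => ?_, hv.congr fun i j => (hzero i j).symm,
    perm_eq_of_lt_iff_lt fun i j => by rw [toPerm_lt_iff, hzero]⟩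
  rw [hneg, hneg, hposi, hposi]
  constructor <;> intro hi hj
  · rw [hwlt i hi, hwgt j hj.not_gt]
    have := hc1 i j (by simp [lt', AbsLT, hi, hj, hij])
    omega
  · rw [hwgt i hi.not_gt, hwlt j hj]
    have := hc1 i j (by simp [lt', AbsLT, hi, hj, hij])
    omega

end SignedPerm

/-- Standardizing `0 w₁ ⋯ w_n` carries the separable signed permutations bijectively to the separable
permutations, and it preserves the numbers of descents and of double descents. -/
theorem sum_sepB {M : Type*} [AddCommMonoid M] (n : ℕ) (f : ℕ → ℕ → M) :
    ∑ w ∈ sepB n, f (DesB w).card (DDesB w).card =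
      ∑ v ∈ sepA (n + 1), f (DesA v).card (DDesA v).card := by
  refine Finset.sum_nbij SignedPerm.toPerm ?_ ?_ ?_ ?_
  · intro w hw
    refine Finset.mem_filter.2 ⟨Finset.mem_univ _, isSeparableA_iff.2 ?_⟩
    exact ((w.isSeparableB_iff).1 (Finset.mem_filter.1 hw).2).2.congr fun i j =>
      (w.toPerm_lt_iff i j).symm
  · refine SignedPerm.toPerm_injOn.mono fun w hw => ?_
    exact ((w.isSeparableB_iff).1 (Finset.mem_filter.1 hw).2).1
  · intro v hv
    obtain ⟨w, h1, h2, rfl⟩ :=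
      SignedPerm.exists_toPerm_eq (isSeparableA_iff.1 (Finset.mem_filter.1 hv).2)
    exact ⟨w, Finset.mem_filter.2 ⟨Finset.mem_univ _, (w.isSeparableB_iff).2 ⟨h1, h2⟩⟩, rfl⟩
  · intro w _
    rw [w.card_DesB, w.card_DDesB]

/-! ### Palindromicity and unimodality from γ-positivity -/

theorem coeff_C_mul_X_pow_mul_one_add_X_pow (c : ℤ) (k r i : ℕ) :
    (C c * X ^ k * (1 + X) ^ r : ℤ[X]).coeff i =
      if k ≤ i then c * (r.choose (i - k) : ℤ) else 0 := by
  rw [mul_assoc, coeff_C_mul, coeff_X_pow_mul']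
  split_ifs
  · rw [coeff_one_add_X_pow]
  · simp

theorem IsGammaPositive.coeff_symm {d : ℕ} {p : ℤ[X]} (h : IsGammaPositive d p) {i : ℕ}
    (hi : i ≤ d) : p.coeff i = p.coeff (d - i) := by
  obtain ⟨γ, -, rfl⟩ := h
  rw [finsetSum_coeff, finsetSum_coeff]
  refine Finset.sum_congr rfl fun k hk => ?_
  rw [Finset.mem_range] at hk
  rw [coeff_C_mul_X_pow_mul_one_add_X_pow, coeff_C_mul_X_pow_mul_one_add_X_pow]
  split_ifs with h1 h2 h2
  · rw [← Nat.choose_symm (by omega)]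
    congr 3
    omega
  · rw [Nat.choose_eq_zero_of_lt (by omega)]
    simp
  · rw [Nat.choose_eq_zero_of_lt (by omega)]
    simp
  · rfl

/-- Each summand is a shifted row of binomial coefficients centred at `d / 2`, which increases up to
the middle; non-negativity of `γ` preserves this in the sum. -/
theorem IsGammaPositive.coeff_le_succ {d : ℕ} {p : ℤ[X]} (h : IsGammaPositive d p) {i : ℕ}
    (hi : i + 1 ≤ d / 2) : p.coeff i ≤ p.coeff (i + 1) := by
  obtain ⟨γ, hγ, rfl⟩ := h
  rw [finsetSum_coeff, finsetSum_coeff]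
  refine Finset.sum_le_sum fun k hk => ?_
  rw [Finset.mem_range] at hk
  rw [coeff_C_mul_X_pow_mul_one_add_X_pow, coeff_C_mul_X_pow_mul_one_add_X_pow]
  split_ifs with h1 h2 h2
  · refine mul_le_mul_of_nonneg_left ?_ (hγ k)
    rw [Nat.sub_add_comm h1]
    exact_mod_cast Nat.choose_le_succ_of_lt_half_left (by omega)
  · omega
  · exact mul_nonneg (hγ k) (by positivity)
  · rfl

theorem IsGammaPositive.natDegree_le {d : ℕ} {p : ℤ[X]} (h : IsGammaPositive d p) :
    p.natDegree ≤ d := by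
  obtain ⟨γ, -, rfl⟩ := h
  refine natDegree_le_iff_coeff_eq_zero.2 fun i hi => ?_
  rw [finsetSum_coeff]
  refine Finset.sum_eq_zero fun k hk => ?_
  rw [Finset.mem_range] at hk
  rw [coeff_C_mul_X_pow_mul_one_add_X_pow, Nat.choose_eq_zero_of_lt (by omega)]
  simp

theorem IsGammaPositive.isPalindromic {d : ℕ} {p : ℤ[X]} (h : IsGammaPositive d p)
    (h0 : p.coeff 0 ≠ 0) : IsPalindromic d p := by
  refine ⟨le_antisymm h.natDegree_le (le_natDegree_of_ne_zero ?_), fun i hi => h.coeff_symm hi⟩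
  rwa [h.coeff_symm le_rfl, Nat.sub_self]

theorem IsGammaPositive.isUnimodal {d : ℕ} {p : ℤ[X]} (h : IsGammaPositive d p)
    (h0 : p.coeff 0 ≠ 0) : IsUnimodal p := by
  have hd := (h.isPalindromic h0).1
  have up : ∀ i j, i ≤ j → j ≤ d / 2 → p.coeff i ≤ p.coeff j := by
    intro i j hij
    induction j, hij using Nat.le_induction with
    | base => intro _; rfl
    | succ j hij ih => exact fun hj => (ih (by omega)).trans (h.coeff_le_succ hj)
  rw [IsUnimodal, hd]
  refine ⟨d / 2, Nat.div_le_self _ _, up, fun i j hi hij hj => ?_⟩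
  -- The second half is reflected onto the first, where the coefficients increase.
  rw [h.coeff_symm hj]
  rcases Nat.lt_or_ge (d / 2) i with hlt | hge
  · rw [h.coeff_symm (hij.trans hj)]
    exact up _ _ (by omega) (by omega)
  · obtain rfl : i = d / 2 := by omega
    rcases Nat.lt_or_ge (d / 2) (d - j) with hlt' | hge'
    -- This occurs only for odd `d` and `j = d / 2`, when the two middle coefficients are equal.
    · rw [show d - j = d - d / 2 by omega, ← h.coeff_symm (by omega)]
    · exact up _ _ hge' le_rfl

theorem mainTheorem3 (n : ℕ) :
    descentPolyB n = descentPolyA (n + 1) ∧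
    descentPolyB n =
      ∑ k ∈ Finset.range (n / 2 + 1),
        C (gammaB n k : ℤ) * X ^ k * (1 + X) ^ (n - 2 * k) ∧
    (∀ k : ℕ, gammaB n k = gammaA (n + 1) k) ∧
    IsGammaPositive n (descentPolyB n) ∧
    IsPalindromic n (descentPolyB n) ∧
    IsUnimodal (descentPolyB n) := by
  have h1 : descentPolyB n = descentPolyA (n + 1) := sum_sepB n fun i _ => (X : ℤ[X]) ^ i
  have h2 : ∀ k, gammaB n k = gammaA (n + 1) k := fun k => by
    rw [gammaB, gammaA, Finset.card_filter, Finset.card_filter]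
    -- The γ-numbers are sums of an indicator of the pair (descents, double descents), so the same
    -- transfer applies.
    exact sum_sepB n fun i j => if j = 0 ∧ i = k then 1 else 0
  have h3 : descentPolyB n = ∑ k ∈ Finset.range (n / 2 + 1),
      C (gammaB n k : ℤ) * X ^ k * (1 + X) ^ (n - 2 * k) := by
    simp only [h1, h2, descentPolyA_eq_sum]
  have h4 : IsGammaPositive n (descentPolyB n) :=
    ⟨fun k => gammaB n k, fun k => Int.natCast_nonneg _, h3⟩
  have h5 : (descentPolyB n).coeff 0 ≠ 0 := by
    rw [h3, finsetSum_coeff, Finset.sum_eq_single 0]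
    · rw [coeff_C_mul_X_pow_mul_one_add_X_pow, h2]
      have := gammaA_zero_pos n
      simp
      omega
    · intro k _ hk
      rw [coeff_C_mul_X_pow_mul_one_add_X_pow, if_neg (by omega)]
    · simp
  exact ⟨h1, h3, h2, h4, h4.isPalindromic h5, h4.isUnimodal h5⟩
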